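/- Let $d\ge 3$. For $0<\delta<\sigma$ let $Y_x\sim N_d(0,(\sigma^2-\delta^2)I)$ $(x\in\mathbb Z^d)$ and $Y'_{x,i}\sim N_d(0,\delta^2 I)$ $((x,i)\in\mathbb Z^d\times\{1,2\})$ be random vectors in $\mathbb R^d$, all mutually independent, and let $$\hat\Pi=\{x+Y_x+Y'_{x,i}:(x,i)\in\mathbb Z^d\times\{1,2\}\}.$$ There exist such $\delta,\sigma$, depending only on $d$, for which $\hat\Pi$ is a point process (measurable for the $\sigma$-algebra on subsets $s$ of $\mathbb R^d$ generated by the counts $s\mapsto|s\cap B|$, $B$ Borel, and almost surely with finitely many points in every ball) with the following properties: 1. $\hat\Pi$ is deletion singular: for every random variable $Z$ with $Z\in\hat\Pi$ almost surely, the laws of $\hat\Pi$ and $\hat\Pi\setminus\{Z\}$ are mutually singular; 2. $\hat\Pi$ is $2$-deletion tolerant: for all random variables $Z_1,Z_2$ that almost surely are distinct and belong to $\hat\Pi$, the law of $\hat\Pi\setminus\{Z_1,Z_2\}$ is absolutely continuous with respect to the law of $\hat\Pi$; 3. $\hat\Pi$ is not rigid, that is, it is not true that for every ball $B\subset\mathbb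 R^d$ there is a measurable function $N_B$ on point configurations with $N_B(\hat\Pi\cap B^c)=|\hat\Pi\cap B|$ almost surely. -/

import Mathlib

open MeasureTheory ProbabilityTheory

noncomputable section

/-- The space of point configurations in `E`: subsets of `E`, carrying the counting
sigma-algebra below (and not the product sigma-algebra of `E → Prop`).
The locally finite configurations form a measurable subset when `E` is a Euclidean space. -/
def PointConfig (E : Type*) : Type _ := Set E

/-- The standard sigma-algebra on point configurations: it is generated by the maps
`s ↦ |s ∩ B|`, `B` a Borel set. -/
instance PointConfig.instMeasurableSpace (E : Type*) [MeasurableSpace E] :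
    MeasurableSpace (PointConfig E) :=
  ⨆ (B : Set E) (_ : MeasurableSet B),
    MeasurableSpace.comap (fun s : Set E => (s ∩ B).encard) inferInstance

section Processes

variable {Ω E : Type*} [MeasurableSpace Ω] [MeasurableSpace E]

/-- The law of a random point set, a measure on the space of configurations. -/
def processLaw (μ : Measure Ω) (P : Ω → Set E) : Measure (PointConfig E) :=
  Measure.map (β := PointConfig E) P μ

/-- A random point set is a point process if it is measurable for the counting sigma-algebra
and almost surely has only finitely many points in each ball. -/
def IsPointProcess [PseudoMetricSpace E] (μ : Measure Ω) (P : Ω → Set E) : Prop :=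
  Measurable (β := PointConfig E) P ∧
    ∀ᵐ ω ∂μ, ∀ (c : E) (r : ℝ), (P ω ∩ Metric.ball c r).Finite

/-- A `P`-point: a random variable `Z` with `Z ∈ P` almost surely. -/
def IsProcessPoint (μ : Measure Ω) (P : Ω → Set E) (Z : Ω → E) : Prop :=
  Measurable Z ∧ ∀ᵐ ω ∂μ, Z ω ∈ P ω

/-- Deletion singularity: for every `P`-point `Z`, the laws of `P` and of `P \ {Z}` are
mutually singular. -/
def IsDeletionSingular (μ : Measure Ω) (P : Ω → Set E) : Prop :=
  ∀ Z : Ω → E, IsProcessPoint μ P Z →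
    processLaw μ P ⟂ₘ processLaw μ (fun ω => P ω \ {Z ω})

/-- `k`-deletion tolerance: for all (almost surely) distinct `P`-points `Z₁, …, Z_k`, the law of
`P \ {Z₁, …, Z_k}` is absolutely continuous with respect to the law of `P`. -/
def IsDeletionTolerant (k : ℕ) (μ : Measure Ω) (P : Ω → Set E) : Prop :=
  ∀ Z : Fin k → Ω → E, (∀ i, IsProcessPoint μ P (Z i)) →
    (∀ᵐ ω ∂μ, Function.Injective fun i => Z i ω) →
    processLaw μ (fun ω => P ω \ Set.range fun i => Z i ω) ≪ processLaw μ P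

/-- Rigidity: for every ball `B` the number of points of `P` in `B` is almost surely
a measurable function of the configuration `P ∩ Bᶜ`. -/
def IsRigid [PseudoMetricSpace E] (μ : Measure Ω) (P : Ω → Set E) : Prop :=
  ∀ (c : E) (r : ℝ), 0 < r → ∃ N : PointConfig E → ℕ∞, Measurable N ∧
    ∀ᵐ ω ∂μ, N (P ω ∩ (Metric.ball c r)ᶜ : Set E) = (P ω ∩ Metric.ball c r).encard

end Processes

/-- The point of `ℤ^d` with coordinates `x`, as a vector of Euclidean space. -/
def latticePoint {d : ℕ} (x : Fin d → ℤ) : EuclideanSpace ℝ (Fin d) :=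
  WithLp.toLp 2 fun j => (x j : ℝ)

/-- The families `Y_x ~ N_d(0, (σ² - δ²) I)`, `x ∈ ℤ^d`, and `Y'_{x,i} ~ N_d(0, δ² I)`,
`(x, i) ∈ ℤ^d × {1, 2}`, all independent of each other. -/
structure IsGaussianPerturbationPair {Ω : Type*} [MeasurableSpace Ω] (μ : Measure Ω) {d : ℕ}
    (σ δ : ℝ) (Y : (Fin d → ℤ) → Ω → EuclideanSpace ℝ (Fin d))
    (Y' : (Fin d → ℤ) × Fin 2 → Ω → EuclideanSpace ℝ (Fin d)) : Prop where
  measurable_site : ∀ x, Measurable (Y x)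
  measurable_point : ∀ p, Measurable (Y' p)
  law_site : ∀ x, HasLaw (Y x)
    (multivariateGaussian 0 ((σ ^ 2 - δ ^ 2) • (1 : Matrix (Fin d) (Fin d) ℝ))) μ
  law_point : ∀ p, HasLaw (Y' p)
    (multivariateGaussian 0 (δ ^ 2 • (1 : Matrix (Fin d) (Fin d) ℝ))) μ
  indep : iIndepFun (Sum.elim Y Y') μ

/-- The random point set `{x + Y_x + Y'_{x,i} : (x, i) ∈ ℤ^d × {1, 2}}`. -/
def pairedLattice {Ω : Type*} {d : ℕ} (Y : (Fin d → ℤ) → Ω → EuclideanSpace ℝ (Fin d))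
    (Y' : (Fin d → ℤ) × Fin 2 → Ω → EuclideanSpace ℝ (Fin d)) (ω : Ω) :
    Set (EuclideanSpace ℝ (Fin d)) :=
  Set.range fun p : (Fin d → ℤ) × Fin 2 => latticePoint p.1 + (Y p.1 ω + Y' p ω)

end

-- Let t² = σ² - δ² be the variance of the common displacement of a pair. First t is taken large,
-- which yields tolerance for every δ; then δ is taken small in terms of t, which yields
-- singularity.
--
-- Singularity. For small δ, along every sequence of distinct pairs the accumulated distance inside
-- the pairs is eventually less than the accumulated distance between consecutive ones
-- (`IsShortPairing`). This is a first moment estimate: give a chain of pairs the weight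
-- exp(a(inside - between)). The steps to fresh sites have expected total weight at most 1/2 when a
-- is large and δ = 1/a, so the total weight of the k-step chains from a given label tends to 0
-- almost surely (`exists_ae_isShortPairing`). If one such configuration were another one minus a
-- point z, following the two pairings alternately from z would give an infinite path without
-- repetitions, on which each pairing would eventually have to be shorter in total than the other
-- (`IsShortPairing.range_ne`). Hence the two laws live on configurations that never coincide, and
-- Lusin separation of analytic sets makes them singular (`mutuallySingular_map_of_ne`).
--
-- Tolerance. To delete the whole pair of a site x₀, draw a random path in ℤ^d from x₀ and move
-- every pair on it to the next site; up to relabelling, the result is the field without x₀.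
-- Averaged over the path, the Cameron-Martin densities of these shifts have second moment at most
-- the mean of (1 + ε)^(number of meetings of two independent paths), with ε small for large t. For
-- d ≥ 3 one coordinate can serve as time and two others can be made so unpredictable that this mean
-- is bounded (`lintegral_prod_meeting_le`). A uniform L² bound over finite windows gives absolute
-- continuity (`randomShift_absolutelyContinuous`, `pointsOff_null`). To delete one point from each
-- of two pairs, note that the two surviving partners can play the role of a single pair: its new
-- individual displacement has a conditional law equivalent to the original one, so this case
-- reduces to the deletion of a site (`ae_range_fieldPoint_diff_notMem`). There are only countably
-- many choices of labels, which covers random choices of the two points.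
--
-- Non-rigidity. Deleting two points inside a ball lowers the count there and leaves the outside
-- unchanged, so 2-deletion tolerance rules out that the outside determines the count.

-- Resampling coordinates of infinite product measures

section InfiniteProduct

open Measure
open scoped ENNReal

variable {ι : Type*} [DecidableEq ι] {X : ι → Type*} [∀ i, MeasurableSpace (X i)]
  (ν : ∀ i, Measure (X i)) [∀ i, IsProbabilityMeasure (ν i)]

lemma measurable_update_pair (i : ι) :
    Measurable fun p : (∀ j, X j) × X i => Function.update p.1 i p.2 := by
  refine measurable_pi_lambda _ fun j => ?_
  rcases eq_or_ne j i with rfl | h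
  · simpa using measurable_snd
  · simp only [Function.update_of_ne h]
    exact (measurable_pi_apply j).comp measurable_fst

/-- Resampling one coordinate independently preserves an infinite product measure. -/
lemma measurePreserving_update (i : ι) :
    MeasurePreserving (fun p : (∀ j, X j) × X i => Function.update p.1 i p.2)
      ((infinitePi ν).prod (ν i)) (infinitePi ν) := by
  refine ⟨measurable_update_pair i, ?_⟩
  refine eq_infinitePi ν fun s t ht => ?_
  have hms : MeasurableSet (Set.pi (s : Set ι) t) :=
    MeasurableSet.pi s.countable_toSet fun j _ => ht j
  rw [map_apply (measurable_update_pair i) hms]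
  have hpre : (fun p : (∀ j, X j) × X i => Function.update p.1 i p.2) ⁻¹' (Set.pi (s : Set ι) t)
      = (Set.pi ((s.erase i : Finset ι) : Set ι) t) ×ˢ (if i ∈ s then t i else Set.univ) := by
    ext ⟨x, u⟩
    simp only [Set.mem_preimage, Set.mem_pi, Finset.mem_coe, Set.mem_prod, Finset.mem_erase]
    constructor
    · intro h
      refine ⟨fun j hj => by simpa [Function.update_of_ne hj.1] using h j hj.2, ?_⟩
      split_ifs with hi
      · simpa using h i hi
      · trivial
    · rintro ⟨h1, h2⟩ j hj
      rcases eq_or_ne j i with rfl | hne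
      · simpa [hj] using h2
      · simpa [Function.update_of_ne hne] using h1 j ⟨hne, hj⟩
  rw [hpre, prod_prod, infinitePi_pi ν fun j _ => ht j]
  split_ifs with hi
  · exact Finset.prod_erase_mul s _ hi
  · rw [Finset.erase_eq_of_notMem hi, measure_univ, mul_one]

lemma lintegral_infinitePi_update (i : ι) {f : (∀ j, X j) → ℝ≥0∞} (hf : Measurable f) :
    ∫⁻ l, f l ∂infinitePi ν
      = ∫⁻ l, ∫⁻ u, f (Function.update l i u) ∂ν i ∂infinitePi ν := by
  rw [← (measurePreserving_update ν i).lintegral_comp hf, lintegral_prod]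
  exact (hf.comp (measurable_update_pair i)).aemeasurable

/-- A substitute for conditioning on all coordinates but one: a factor that ignores the coordinate
`i` comes out of the average over it. Independence enters the later moment estimates in this form.
-/
lemma lintegral_mul_of_invariant (i : ι) {f h : (∀ j, X j) → ℝ≥0∞} (hf : Measurable f)
    (hh : Measurable h) (hinv : ∀ l u, f (Function.update l i u) = f l) :
    ∫⁻ l, f l * h l ∂infinitePi ν
      = ∫⁻ l, f l * ∫⁻ u, h (Function.update l i u) ∂ν i ∂infinitePi ν := by
  rw [lintegral_infinitePi_update ν i (f := fun l => f l * h l) (hf.mul hh)]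
  refine lintegral_congr fun l => ?_
  simp only [hinv]
  exact lintegral_const_mul _ ((hh.comp (measurable_update_pair i)).comp measurable_prodMk_left)

lemma lintegral_mul_le_of_invariant (i : ι) {f h : (∀ j, X j) → ℝ≥0∞} (hf : Measurable f)
    (hh : Measurable h) (hinv : ∀ l u, f (Function.update l i u) = f l) {c : ℝ≥0∞}
    (hc : ∀ l, ∫⁻ u, h (Function.update l i u) ∂ν i ≤ c) :
    ∫⁻ l, f l * h l ∂infinitePi ν ≤ c * ∫⁻ l, f l ∂infinitePi ν := by
  rw [lintegral_mul_of_invariant ν i hf hh hinv, ← lintegral_const_mul _ hf]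
  exact lintegral_mono fun l => by rw [mul_comm]; gcongr; exact hc l

lemma ae_update_of_ae (i : ι) {p : (∀ j, X j) → Prop} (hp : ∀ᵐ l ∂infinitePi ν, p l) :
    ∀ᵐ l ∂infinitePi ν, ∀ᵐ u ∂ν i, p (Function.update l i u) :=
  ae_ae_of_ae_prod ((measurePreserving_update ν i).quasiMeasurePreserving.ae hp)

lemma ae_of_ae_update (i : ι) {p : (∀ j, X j) → Prop} (hm : MeasurableSet {l | p l})
    (hp : ∀ᵐ l ∂infinitePi ν, ∀ᵐ u ∂ν i, p (Function.update l i u)) :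
    ∀ᵐ l ∂infinitePi ν, p l := by
  rw [← (measurePreserving_update ν i).map_eq,
    ae_map_iff (measurable_update_pair i).aemeasurable hm,
    ae_prod_iff_ae_ae (p := fun x => p (Function.update x.1 i x.2)) (measurable_update_pair i hm)]
  exact hp

lemma lintegral_prod_coordinates (F : Finset ι) {f : ∀ i, X i → ℝ≥0∞}
    (hf : ∀ i, Measurable (f i)) :
    ∫⁻ l, ∏ i ∈ F, f i (l i) ∂infinitePi ν = ∏ i ∈ F, ∫⁻ u, f i u ∂ν i := by
  induction F using Finset.induction_on with
  | empty => simp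
  | insert i F hi ih =>
    simp_rw [Finset.prod_insert hi]
    simp_rw [mul_comm (f i _)]
    rw [lintegral_mul_of_invariant ν i (f := fun l => ∏ j ∈ F, f j (l j))
      (h := fun l => f i (l i))
      (Finset.measurable_fun_prod _ fun j _ => (hf j).comp (measurable_pi_apply j))
      ((hf i).comp (measurable_pi_apply i))]
    · simp only [Function.update_self]
      rw [lintegral_mul_const (f := fun l : ∀ j, X j => ∏ j ∈ F, f j (l j)) _
        (Finset.measurable_fun_prod _ fun j _ => (hf j).comp (measurable_pi_apply j)), ih,
        mul_comm]
    · intro l u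
      refine Finset.prod_congr rfl fun j hj => ?_
      rw [Function.update_of_ne (ne_of_mem_of_not_mem hj hi)]

open Classical in
/-- If each `θ i` transports `ν i` to a measure with density `D i`, then applying `θ i` in the
coordinates of a finite set `F` has density `∏ i ∈ F, D i`. -/
lemma lintegral_comp_piecewise (F : Finset ι) {θ : ∀ i, X i → X i} {D : ∀ i, X i → ℝ≥0∞}
    (hθ : ∀ i, Measurable (θ i)) (hD : ∀ i, Measurable (D i))
    (h : ∀ i, ∀ g : X i → ℝ≥0∞, Measurable g → ∫⁻ u, g (θ i u) ∂ν i = ∫⁻ u, g u * D i u ∂ν i)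
    {f : (∀ j, X j) → ℝ≥0∞} (hf : Measurable f) :
    ∫⁻ l, f (fun i => if i ∈ F then θ i (l i) else l i) ∂infinitePi ν
      = ∫⁻ l, f l * ∏ i ∈ F, D i (l i) ∂infinitePi ν := by
  have hshift : ∀ G : Finset ι,
      Measurable fun (l : ∀ j, X j) (i : ι) => if i ∈ G then θ i (l i) else l i := by
    intro G
    refine measurable_pi_lambda _ fun i => ?_
    split_ifs
    · exact (hθ i).comp (measurable_pi_apply i)
    · exact measurable_pi_apply i
  have hDm : ∀ G : Finset ι, Measurable fun l : ∀ j, X j => ∏ i ∈ G, D i (l i) := fun G =>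
    Finset.measurable_fun_prod _ fun j _ => (hD j).comp (measurable_pi_apply j)
  induction F using Finset.induction_on generalizing f with
  | empty => simp
  | insert i F hi ih =>
    have hone : Measurable fun l : ∀ j, X j => Function.update l i (θ i (l i)) :=
      (measurable_update_pair i).comp
        (measurable_id.prodMk ((hθ i).comp (measurable_pi_apply i)))
    have hstep : ∀ l : ∀ j, X j, (fun j => if j ∈ insert i F then θ j (l j) else l j)
        = Function.update (fun j => if j ∈ F then θ j (l j) else l j) i
          (θ i ((fun j => if j ∈ F then θ j (l j) else l j) i)) := by
      intro l
      funext j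
      rcases eq_or_ne j i with rfl | hne
      · simp [hi]
      · simp [hne]
    have hinv : ∀ (l : ∀ j, X j) u,
        ∏ j ∈ F, D j (Function.update l i u j) = ∏ j ∈ F, D j (l j) := fun l u =>
      Finset.prod_congr rfl fun j hj => by
        rw [Function.update_of_ne (ne_of_mem_of_not_mem hj hi)]
    simp_rw [hstep]
    rw [ih (f := fun l => f (Function.update l i (θ i (l i)))) (hf.comp hone)]
    simp_rw [Finset.prod_insert hi, mul_comm (f _)]
    rw [lintegral_mul_of_invariant ν i (h := fun l => f (Function.update l i (θ i (l i))))
      (hDm F) (hf.comp hone) hinv]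
    have hr : ∀ l : ∀ j, X j, (D i (l i) * ∏ j ∈ F, D j (l j)) * f l
        = (∏ j ∈ F, D j (l j)) * (f l * D i (l i)) := fun l => by ring
    simp_rw [hr]
    rw [lintegral_mul_of_invariant ν i (h := fun l => f l * D i (l i)) (hDm F)
      (hf.mul ((hD i).comp (measurable_pi_apply i))) hinv]
    refine lintegral_congr fun l => ?_
    congr 1
    simp only [Function.update_self, Function.update_idem]
    exact h i (fun u => f (Function.update l i u))
      (hf.comp ((measurable_update_pair i).comp measurable_prodMk_left))

end InfiniteProduct

-- Measurability of random point configurations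

section Configurations

/-- A set, viewed as a point configuration. -/
def asConfig {E : Type*} (s : Set E) : PointConfig E := s

variable {Ω E : Type*} [MeasurableSpace Ω] [MeasurableSpace E]

lemma measurable_encard_inter {B : Set E} (hB : MeasurableSet B) :
    Measurable (α := PointConfig E) fun s : Set E => (s ∩ B).encard :=
  measurable_iff_comap_le.2 (le_iSup₂_of_le (f := fun (B : Set E) (_ : MeasurableSet B) =>
    MeasurableSpace.comap (fun s : Set E => (s ∩ B).encard) inferInstance) B hB le_rfl)

lemma measurable_config_iff {P : Ω → Set E} :
    Measurable (β := PointConfig E) P ↔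
      ∀ B : Set E, MeasurableSet B → Measurable fun ω => (P ω ∩ B).encard :=
  ⟨fun h _ hB => (measurable_encard_inter hB).comp h, fun h =>
    measurable_iff_le_map.2 (iSup₂_le fun B hB =>
      MeasurableSpace.comap_le_iff_le_map.2 fun _ ht => h B hB ht)⟩

lemma measurable_config_inter {C : Set E} (hC : MeasurableSet C) :
    Measurable (α := PointConfig E) (β := PointConfig E) fun s : Set E => (s ∩ C : Set E) := by
  refine (measurable_config_iff (Ω := PointConfig E) (P := fun s : Set E => s ∩ C)).2
    fun B hB => ?_
  have : (fun s : PointConfig E => ((show Set E from s) ∩ C ∩ B).encard)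
      = fun s : PointConfig E => ((show Set E from s) ∩ (C ∩ B)).encard :=
    funext fun s => by rw [Set.inter_assoc]
  exact this ▸ measurable_encard_inter (hC.inter hB)

/-- The random set of those values `f i ω` for which `ω ∈ C i` is measurable. -/
lemma measurable_config_of_countable {ι : Type*} [Countable ι] [MeasurableEq E] {f : ι → Ω → E}
    (hf : ∀ i, Measurable (f i)) {C : ι → Set Ω} (hC : ∀ i, MeasurableSet (C i)) :
    Measurable (β := PointConfig E) fun ω => {z | ∃ i, ω ∈ C i ∧ f i ω = z} := by
  refine measurable_config_iff.2 fun B hB => ?_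
  -- Several labels may give the same point, so "at least n points in B" means that some n labels
  -- are active with pairwise different values in B. This is a countable union of measurable events.
  have key : ∀ n : ℕ, MeasurableSet
      {ω | (n : ℕ∞) ≤ ({z | ∃ i, ω ∈ C i ∧ f i ω = z} ∩ B).encard} := by
    intro n
    have : {ω | (n : ℕ∞) ≤ ({z | ∃ i, ω ∈ C i ∧ f i ω = z} ∩ B).encard}
        = ⋃ (t : Finset ι) (_ : t.card = n), ((⋂ i ∈ t, (C i ∩ f i ⁻¹' B)) ∩
          ⋂ i ∈ t, ⋂ j ∈ t, ⋂ (_ : i ≠ j), {ω | f i ω = f j ω}ᶜ) := by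
      ext ω
      simp only [Set.mem_ofPred_eq, Set.mem_iUnion, Set.mem_inter_iff, Set.mem_iInter,
        Set.mem_preimage, Set.mem_compl_iff]
      constructor
      · intro h
        obtain ⟨u, hu, hcard⟩ := Set.exists_subset_encard_eq h
        have hfin : u.Finite := Set.finite_of_encard_eq_coe hcard
        classical
        rcases isEmpty_or_nonempty ι with hι | hι
        · have hu0 : u = ∅ := Set.eq_empty_of_forall_notMem fun z hz => hι.elim (hu hz).1.choose
          exact ⟨∅, by
            have := hcard
            rw [hu0, Set.encard_empty] at this
            exact_mod_cast this, by simp, by simp⟩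
        choose! g hg using fun z (hz : z ∈ u) => (hu hz).1
        have hinj : Set.InjOn g (hfin.toFinset : Set E) := by
          intro a ha b hb hab
          rw [Set.Finite.coe_toFinset] at ha hb
          rw [← (hg a ha).2, ← (hg b hb).2, hab]
        refine ⟨hfin.toFinset.image g, ?_, ?_, ?_⟩
        · rw [Finset.card_image_of_injOn hinj]
          rw [hfin.encard_eq_coe_toFinset_card] at hcard
          exact_mod_cast hcard
        · intro i hi
          simp only [Finset.mem_image, Set.Finite.mem_toFinset] at hi
          obtain ⟨z, hz, rfl⟩ := hi
          exact ⟨(hg z hz).1, by rw [(hg z hz).2]; exact (hu hz).2⟩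
        · intro i hi j hj hij
          simp only [Finset.mem_image, Set.Finite.mem_toFinset] at hi hj
          obtain ⟨z, hz, rfl⟩ := hi
          obtain ⟨w, hw, rfl⟩ := hj
          rw [(hg z hz).2, (hg w hw).2]
          rintro rfl
          exact hij rfl
      · rintro ⟨t, rfl, h1, h2⟩
        classical
        have hinj : Set.InjOn (fun i => f i ω) (t : Set ι) := fun i hi j hj hij => by
          by_contra hne
          exact h2 i hi j hj hne hij
        have : ((fun i => f i ω) '' (t : Set ι)).encard = t.card := by
          rw [hinj.encard_image, Set.encard_coe_eq_coe_finsetCard]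
        rw [← this]
        refine Set.encard_le_encard ?_
        rintro _ ⟨i, hi, rfl⟩
        exact ⟨⟨i, (h1 i hi).1, rfl⟩, (h1 i hi).2⟩
    rw [this]
    refine MeasurableSet.iUnion fun t => MeasurableSet.iUnion fun _ => MeasurableSet.inter ?_ ?_
    · exact t.measurableSet_biInter fun i _ => (hC i).inter (hf i hB)
    · refine t.measurableSet_biInter fun i _ => t.measurableSet_biInter fun j _ =>
        MeasurableSet.iInter fun _ => (measurableSet_eq_fun (hf i) (hf j)).compl
  refine measurable_to_countable' fun x => ?_
  induction x using ENat.recTopCoe with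
  | top =>
    have : (fun ω => ({z | ∃ i, ω ∈ C i ∧ f i ω = z} ∩ B).encard) ⁻¹' {⊤}
        = ⋂ n : ℕ, {ω | (n : ℕ∞) ≤ ({z | ∃ i, ω ∈ C i ∧ f i ω = z} ∩ B).encard} := by
      ext ω
      simp only [Set.mem_preimage, Set.mem_singleton_iff, Set.mem_iInter, Set.mem_ofPred_eq]
      exact ENat.eq_top_iff_forall_ge
    rw [this]
    exact MeasurableSet.iInter key
  | coe n =>
    have : (fun ω => ({z | ∃ i, ω ∈ C i ∧ f i ω = z} ∩ B).encard) ⁻¹' {(n : ℕ∞)}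
        = {ω | (n : ℕ∞) ≤ ({z | ∃ i, ω ∈ C i ∧ f i ω = z} ∩ B).encard} \
          {ω | ((n + 1 : ℕ) : ℕ∞) ≤ ({z | ∃ i, ω ∈ C i ∧ f i ω = z} ∩ B).encard} := by
      ext ω
      simp only [Set.mem_preimage, Set.mem_singleton_iff, Set.mem_sdiff, Set.mem_ofPred_eq, not_le]
      push_cast
      rw [ENat.lt_natCast_add_one_iff, le_antisymm_iff, and_comm]
    rw [this]
    exact (key n).diff (key (n + 1))

end Configurations

-- Singularity of laws of configurations by Lusin separation

section Singularity

variable {E : Type*} [TopologicalSpace E] [SecondCountableTopology E] [MeasurableSpace E]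
  [BorelSpace E]

omit [MeasurableSpace E] [BorelSpace E] in
/-- The countably many basic open sets hit by a configuration determine its closure. -/
lemma subset_of_hitting_iff {s s' : Set E} (hs' : IsClosed s')
    (h : ∀ B ∈ TopologicalSpace.countableBasis E, (s ∩ B).Nonempty → (s' ∩ B).Nonempty) :
    s ⊆ s' := by
  intro z hz
  by_contra hz'
  obtain ⟨B, hB, hzB, hsub⟩ :=
    (TopologicalSpace.isBasis_countableBasis E).exists_subset_of_mem_open
      (show z ∈ s'ᶜ from hz') hs'.isOpen_compl
  obtain ⟨w, hw, hwB⟩ := h B hB ⟨z, hz, hzB⟩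
  exact hsub hwB hw

open Classical in
/-- If two random closed configurations, as functions of a.s. events in standard Borel spaces,
can never coincide, then their laws are mutually singular. -/
lemma mutuallySingular_map_of_ne {L₁ L₂ : Type*} [MeasurableSpace L₁] [StandardBorelSpace L₁]
    [MeasurableSpace L₂] [StandardBorelSpace L₂] {m₁ : Measure L₁} {m₂ : Measure L₂}
    {F₁ : L₁ → Set E} {F₂ : L₂ → Set E} (h₁ : Measurable (β := PointConfig E) F₁)
    (h₂ : Measurable (β := PointConfig E) F₂) {p₁ : L₁ → Prop} {p₂ : L₂ → Prop}
    (hp₁ : ∀ᵐ l ∂m₁, p₁ l) (hp₂ : ∀ᵐ l ∂m₂, p₂ l)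
    (hc₁ : ∀ l, p₁ l → IsClosed (F₁ l)) (hc₂ : ∀ l, p₂ l → IsClosed (F₂ l))
    (hne : ∀ l₁ l₂, p₁ l₁ → p₂ l₂ → F₁ l₁ ≠ F₂ l₂) :
    m₁.map (β := PointConfig E) F₁ ⟂ₘ m₂.map (β := PointConfig E) F₂ := by
  -- Recording which basic open sets are hit maps configurations measurably into a countable power
  -- of `Bool`, a Polish space where analytic sets can be separated, and loses nothing on closed
  -- configurations.
  let G : PointConfig E → (TopologicalSpace.countableBasis E → Bool) :=
    fun s B => decide ((show Set E from s) ∩ (B : Set E)).Nonempty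
  have : Countable (TopologicalSpace.countableBasis E) :=
    (TopologicalSpace.countable_countableBasis E).to_subtype
  have hG : Measurable G := by
    refine measurable_pi_lambda _ fun B => ?_
    have hB : MeasurableSet (B : Set E) :=
      (TopologicalSpace.isOpen_of_mem_countableBasis B.2).measurableSet
    have : (fun s => G s B) = (fun n : ℕ∞ => decide (n ≠ 0)) ∘
        fun s : Set E => (s ∩ (B : Set E)).encard := by
      funext s
      simp only [G, Function.comp, ne_eq, Set.encard_eq_zero, Set.nonempty_iff_ne_empty]
    rw [this]
    exact (measurable_of_countable _).comp (measurable_encard_inter hB)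
  -- The properties `p₁`, `p₂` need not be measurable (a short pairing quantifies over uncountably
  -- many chains), so they are replaced by measurable subsets of full measure.
  obtain ⟨S₁, hS₁p, hS₁m, hS₁⟩ : ∃ S ⊆ {l | p₁ l}, MeasurableSet S ∧ m₁ Sᶜ = 0 :=
    ⟨_, Set.compl_subset_comm.1 (subset_toMeasurable m₁ {l | p₁ l}ᶜ),
      (measurableSet_toMeasurable _ _).compl, by
        rw [compl_compl, measure_toMeasurable]; exact hp₁⟩
  obtain ⟨S₂, hS₂p, hS₂m, hS₂⟩ : ∃ S ⊆ {l | p₂ l}, MeasurableSet S ∧ m₂ Sᶜ = 0 :=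
    ⟨_, Set.compl_subset_comm.1 (subset_toMeasurable m₂ {l | p₂ l}ᶜ),
      (measurableSet_toMeasurable _ _).compl, by
        rw [compl_compl, measure_toMeasurable]; exact hp₂⟩
  have ha₁ : AnalyticSet ((G ∘ F₁) '' S₁) := hS₁m.analyticSet_image (hG.comp h₁)
  have ha₂ : AnalyticSet ((G ∘ F₂) '' S₂) := hS₂m.analyticSet_image (hG.comp h₂)
  have hdisj : Disjoint ((G ∘ F₁) '' S₁) ((G ∘ F₂) '' S₂) := by
    rw [Set.disjoint_left]
    rintro _ ⟨l₁, hl₁, rfl⟩ ⟨l₂, hl₂, heq⟩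
    have hiff : ∀ B ∈ TopologicalSpace.countableBasis E,
        ((F₂ l₂ ∩ B).Nonempty ↔ (F₁ l₁ ∩ B).Nonempty) := by
      intro B hB
      have := congrFun heq ⟨B, hB⟩
      simpa only [G, Function.comp, decide_eq_decide] using this
    refine hne l₁ l₂ (hS₁p hl₁) (hS₂p hl₂) (Set.Subset.antisymm ?_ ?_)
    · exact subset_of_hitting_iff (hc₂ _ (hS₂p hl₂)) fun B hB => (hiff B hB).2
    · exact subset_of_hitting_iff (hc₁ _ (hS₁p hl₁)) fun B hB => (hiff B hB).1
  obtain ⟨U, hU₁, hU₂, hUm⟩ := ha₁.measurablySeparable ha₂ hdisj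
  refine ⟨(G ⁻¹' U)ᶜ, (hG hUm).compl, ?_, ?_⟩
  · rw [Measure.map_apply h₁ (hG hUm).compl]
    refine measure_mono_null ?_ hS₁
    intro l hl hlS
    exact hl (hU₁ ⟨l, hlS, rfl⟩)
  · rw [compl_compl, Measure.map_apply h₂ (hG hUm)]
    refine measure_mono_null ?_ hS₂
    intro l hl hlS
    exact Set.disjoint_left.1 hU₂ ⟨l, hlS, rfl⟩ hl

end Singularity

-- Short pairings and the alternating path argument

section Pairings

variable {S E : Type*}

/-- The other point of the same site. -/
def partner (q : S × Fin 2) : S × Fin 2 := (q.1, q.2.rev)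

@[simp] lemma partner_partner (q : S × Fin 2) : partner (partner q) = q := by simp [partner]

lemma partner_fst (q : S × Fin 2) : (partner q).1 = q.1 := rfl

lemma partner_ne (q : S × Fin 2) : partner q ≠ q := by
  obtain ⟨x, i⟩ := q
  simp only [partner, ne_eq, Prod.mk.injEq, true_and]
  revert i
  decide

lemma eq_or_eq_partner {q q' : S × Fin 2} (h : q.1 = q'.1) : q = q' ∨ q = partner q' := by
  obtain ⟨x, i⟩ := q
  obtain ⟨y, j⟩ := q'
  simp only [partner, Prod.mk.injEq]
  have : ∀ i j : Fin 2, i = j ∨ i = j.rev := by decide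
  rcases this i j with h' | h'
  · exact .inl ⟨h, h'⟩
  · exact .inr ⟨h, h'⟩

/-- Along every sequence of distinct sites, the total distance within the pairs is eventually
smaller than the total distance between consecutive pairs. -/
def IsShortPairing (c : E → E → ℝ) (p : S × Fin 2 → E) : Prop :=
  ∀ ch : ℕ → S × Fin 2, (Function.Injective fun n => (ch n).1) →
    ∀ᶠ k in Filter.atTop, ∑ j ∈ Finset.range (k + 1), c (p (ch j)) (p (partner (ch j)))
      < ∑ j ∈ Finset.range k, c (p (partner (ch j))) (p (ch (j + 1)))

/-- The orbit of the unique fixed point of `f` under `f ∘ g`, where `f` is an involution and `g` a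
fixed-point free involution, never returns. -/
lemma involution_iterate_ne {α : Type*} {f g : α → α} {a : α} (hf : ∀ x, f (f x) = x)
    (hg : ∀ x, g (g x) = x) (hfa : ∀ x, f x = x ↔ x = a) (hga : ∀ x, g x ≠ x) (n : ℕ) :
    g ((f ∘ g)^[n] a) ≠ a := by
  have hfg : ∀ m x, (g ∘ f)^[m] ((f ∘ g)^[m] x) = x := by
    intro m x
    exact (Function.LeftInverse.iterate (f := f ∘ g) (g := g ∘ f)
      (fun y => by simp [hf, hg]) m) x
  have hgc : ∀ m x, g ((f ∘ g)^[m] x) = (g ∘ f)^[m] (g x) := by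
    intro m x
    exact (Function.Semiconj.iterate_right (f := g) (ga := f ∘ g) (gb := g ∘ f)
      (fun y => by simp) m) x
  have hfc : ∀ m x, f ((g ∘ f)^[m] x) = (f ∘ g)^[m] (f x) := by
    intro m x
    exact (Function.Semiconj.iterate_right (f := f) (ga := g ∘ f) (gb := f ∘ g)
      (fun y => by simp) m) x
  -- The word g(fg)ⁿ is a palindrome in two involutions, hence a conjugate of its middle letter. If
  -- it fixes `a`, then the middle letter fixes the point reached from `a` halfway.
  intro h
  have hcancel : ∀ m, Function.Injective ((g ∘ f)^[m]) := by
    have hi : Function.Injective (g ∘ f) := fun x y hxy => by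
      have := congrArg (fun z => f (g z)) hxy
      simpa [hf, hg] using this
    exact fun m => hi.iterate m
  rcases Nat.even_or_odd' n with ⟨m, rfl | rfl⟩
  · -- the middle letter is `g`
    have h1 : (g ∘ f)^[m] (g ((f ∘ g)^[m] a)) = (g ∘ f)^[m] ((f ∘ g)^[m] a) := by
      rw [hfg, ← hgc, ← Function.iterate_add_apply, ← two_mul, h]
    exact hga _ (hcancel m h1)
  · -- the middle letter is `f`
    have h2 : g ((f ∘ g)^[2 * m + 1] a) = (g ∘ f)^[m] (g (f (g ((f ∘ g)^[m] a)))) := by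
      rw [show 2 * m + 1 = m + (m + 1) by ring, Function.iterate_add_apply, hgc,
        Function.iterate_succ_apply']
      simp
    have h3 : (g ∘ f)^[m] (g (f (g ((f ∘ g)^[m] a)))) = (g ∘ f)^[m] ((f ∘ g)^[m] a) := by
      rw [hfg, ← h2, h]
    have h4 := hcancel m h3
    have h5 : f (g ((f ∘ g)^[m] a)) = g ((f ∘ g)^[m] a) := by
      rw [← hg (f (g ((f ∘ g)^[m] a))), h4]
    -- The only fixed point of `f` is `a`, so the orbit would already violate the claim at time `m`,
    -- which is less than n = 2m + 1.
    exact involution_iterate_ne hf hg hfa hga m ((hfa _).1 h5)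
termination_by n
decreasing_by omega

/-- Two short pairings cannot parametrize two sets that differ by exactly one point. -/
lemma IsShortPairing.range_ne {c : E → E → ℝ} (hc0 : ∀ x y, 0 ≤ c x y)
    {p p' : S × Fin 2 → E} (hp : Function.Injective p)
    (hp' : Function.Injective p') (h : IsShortPairing c p) (h' : IsShortPairing c p') {z : E}
    (hz : z ∈ Set.range p') : Set.range p ≠ Set.range p' \ {z} := by
  intro heq
  obtain ⟨a, rfl⟩ := hz
  have hH : ∀ b, b ≠ a → ∃ q, p q = p' b := fun b hb => by
    have : p' b ∈ Set.range p := heq ▸ ⟨⟨b, rfl⟩, fun h => hb (hp' h)⟩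
    exact this
  have hK : ∀ q, ∃ b, b ≠ a ∧ p' b = p q := fun q => by
    have : p q ∈ Set.range p' \ {p' a} := heq ▸ ⟨q, rfl⟩
    obtain ⟨⟨b, hb⟩, hne⟩ := this
    exact ⟨b, fun h => hne (by rw [← hb, h]; rfl), hb⟩
  have : Nonempty (S × Fin 2) := ⟨a⟩
  choose! H hHp using hH
  choose K hKa hKp using hK
  have hHK : ∀ q, H (K q) = q := fun q => hp (by rw [hHp _ (hKa q), hKp])
  have hKH : ∀ b, b ≠ a → K (H b) = b := fun b hb => hp' (by rw [hKp, hHp b hb])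
  classical
  -- The pairing of `p` carried over to the labels of `p'`. The label `a` of the removed point has
  -- no mate and becomes the only fixed point.
  let f : S × Fin 2 → S × Fin 2 := fun b => if b = a then a else K (partner (H b))
  have hfne : ∀ b, b ≠ a → f b = K (partner (H b)) := fun b hb => if_neg hb
  have hf : ∀ b, f (f b) = b := by
    intro b
    by_cases hb : b = a
    · simp [f, hb]
    · rw [hfne b hb, hfne _ (hKa _), hHK, partner_partner, hKH b hb]
  have hfa : ∀ b, f b = b ↔ b = a := by
    intro b
    refine ⟨fun hb => ?_, fun hb => by simp [f, hb]⟩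
    by_contra hne
    rw [hfne b hne] at hb
    have := congrArg H hb
    rw [hHK] at this
    exact partner_ne _ this
  let v : ℕ → S × Fin 2 := fun n => (f ∘ partner)^[n] a
  have hv : ∀ n, v (n + 1) = f (partner (v n)) := fun n => Function.iterate_succ_apply' _ _ _
  have hva : ∀ n, partner (v n) ≠ a := fun n =>
    involution_iterate_ne hf partner_partner hfa partner_ne n
  have hinjT : Function.Injective (f ∘ partner) := fun x y hxy => by
    have := congrArg (fun z => partner (f z)) hxy
    simpa [hf] using this
  have hret : ∀ n, v (n + 1) ≠ a := by
    intro n hn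
    rw [hv] at hn
    have h2 : partner (v n) = a := by
      rw [← hf (partner (v n)), hn]
      exact (hfa a).2 rfl
    exact hva n h2
  have hvinj' : ∀ m n, v m ≠ v (m + n + 1) := by
    intro m n hmn
    have : v (m + n + 1) = (f ∘ partner)^[m] (v (n + 1)) := by
      rw [add_assoc]; exact Function.iterate_add_apply _ _ _ _
    rw [this] at hmn
    exact hret n (hinjT.iterate m hmn).symm
  have hvpart : ∀ m n, v m ≠ partner (v n) := by
    intro m n hmn
    have h1 : ∀ k x, (f ∘ partner)^[k] (partner ((f ∘ partner)^[k] x)) = partner x := by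
      intro k
      induction k with
      | zero => simp
      | succ k ih =>
        intro x
        rw [Function.iterate_succ_apply' _ k x, Function.iterate_succ_apply]
        simp only [Function.comp, partner_partner]
        rw [hf]
        exact ih x
    have h2 := h1 n a
    rw [show (f ∘ partner)^[n] a = v n from rfl, ← hmn, ← Function.iterate_add_apply] at h2
    refine hva (n + m) ?_
    change partner ((f ∘ partner)^[n + m] a) = a
    rw [h2, partner_partner]
  have hsite : ∀ m n, (v m).1 = (v n).1 → m = n := by
    intro m n hmn
    rcases eq_or_eq_partner hmn with h1 | h1
    · rcases lt_trichotomy m n with hlt | rfl | hlt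
      · obtain ⟨k, rfl⟩ := Nat.exists_eq_add_of_lt hlt
        exact absurd h1 (hvinj' m k)
      · rfl
      · obtain ⟨k, rfl⟩ := Nat.exists_eq_add_of_lt hlt
        exact absurd h1.symm (hvinj' n k)
    · exact absurd h1 (hvpart m n)
  let w : ℕ → S × Fin 2 := fun n => H (partner (v n))
  have hw : ∀ n, p (w n) = p' (partner (v n)) := fun n => hHp _ (hva n)
  have hwp : ∀ n, p (partner (w n)) = p' (v (n + 1)) := by
    intro n
    rw [hv, hfne _ (hva n), hKp]
  have hwsite : Function.Injective fun n => (w n).1 := by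
    intro m n hmn
    rcases eq_or_eq_partner hmn with h1 | h1
    · have h2 := congrArg p h1
      rw [hw, hw] at h2
      have h3 := congrArg Prod.fst (hp' h2)
      rw [partner_fst, partner_fst] at h3
      exact hsite m n h3
    · have h2 := congrArg p h1
      rw [hw, hwp] at h2
      exact absurd (hp' h2).symm (hvpart (n + 1) m)
  -- The chains `v` for `p'` and `w` for `p` run along the same path: the inside distances of `w`
  -- are the between distances of `v`, and the between distances of `w` are the inside distances of
  -- `v` with index moved by one. The two inequalities at a common `k` therefore contradict each
  -- other once the nonnegative end terms are dropped.
  obtain ⟨k, hk, hk'⟩ := ((h w hwsite).and (h' v fun m n => hsite m n)).exists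
  simp only [hw, hwp] at hk
  have e1 : ∑ j ∈ Finset.range k, c (p' (partner (v j))) (p' (v (j + 1)))
      ≤ ∑ j ∈ Finset.range (k + 1), c (p' (partner (v j))) (p' (v (j + 1))) := by
    rw [Finset.sum_range_succ]
    linarith [hc0 (p' (partner (v k))) (p' (v (k + 1)))]
  have e2 : ∑ j ∈ Finset.range k, c (p' (v (j + 1))) (p' (partner (v (j + 1))))
      ≤ ∑ j ∈ Finset.range (k + 1), c (p' (v j)) (p' (partner (v j))) := by
    rw [Finset.sum_range_succ']
    linarith [hc0 (p' (v 0)) (p' (partner (v 0)))]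
  linarith

end Pairings

-- Gaussian shifts, exponential moments and lattice sums

section GaussianFacts

open scoped ENNReal NNReal

/-- The density of the shift by `s` of a centred Gaussian of variance `v`. -/
noncomputable def shiftDensity (v : ℝ≥0) (s u : ℝ) : ℝ≥0∞ :=
  ENNReal.ofReal (Real.exp ((s * u - s ^ 2 / 2) / v))

lemma measurable_shiftDensity (v : ℝ≥0) (s : ℝ) : Measurable (shiftDensity v s) := by
  unfold shiftDensity; fun_prop

lemma lintegral_gaussianReal_eq {v : ℝ≥0} (hv : v ≠ 0) {g : ℝ → ℝ≥0∞} (hg : Measurable g) :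
    ∫⁻ u, g u ∂gaussianReal 0 v = ∫⁻ u, gaussianPDF 0 v u * g u := by
  rw [gaussianReal_of_var_ne_zero _ hv,
    lintegral_withDensity_eq_lintegral_mul _ (measurable_gaussianPDF 0 v) hg]
  rfl

lemma lintegral_gaussianReal_add {v : ℝ≥0} (hv : v ≠ 0) (s : ℝ) {g : ℝ → ℝ≥0∞}
    (hg : Measurable g) :
    ∫⁻ u, g (u + s) ∂gaussianReal 0 v = ∫⁻ u, g u * shiftDensity v s u ∂gaussianReal 0 v := by
  rw [lintegral_gaussianReal_eq hv (g := fun u => g (u + s)) (by fun_prop),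
    lintegral_gaussianReal_eq hv (g := fun u => g u * shiftDensity v s u)
      (hg.mul (measurable_shiftDensity v s)),
    ← lintegral_add_right_eq_self (fun u => gaussianPDF 0 v u * (g u * shiftDensity v s u)) s]
  refine lintegral_congr fun u => ?_
  have hv' : (v : ℝ) ≠ 0 := by exact_mod_cast hv
  have : gaussianPDF 0 v u = gaussianPDF 0 v (u + s) * shiftDensity v s (u + s) := by
    simp only [gaussianPDF, shiftDensity, gaussianPDFReal]
    rw [← ENNReal.ofReal_mul (by positivity), mul_assoc (√_)⁻¹, ← Real.exp_add]
    congr 3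
    field_simp
    ring
  rw [this]
  ring

lemma lintegral_shiftDensity {v : ℝ≥0} (hv : v ≠ 0) (s : ℝ) :
    ∫⁻ u, shiftDensity v s u ∂gaussianReal 0 v = 1 := by
  have := lintegral_gaussianReal_add hv s (g := fun _ => 1) measurable_const
  simpa using this.symm

lemma lintegral_shiftDensity_mul {v : ℝ≥0} (hv : v ≠ 0) (s s' : ℝ) :
    ∫⁻ u, shiftDensity v s u * shiftDensity v s' u ∂gaussianReal 0 v
      = ENNReal.ofReal (Real.exp (s * s' / v)) := by
  rw [← lintegral_gaussianReal_add hv s' (measurable_shiftDensity v s)]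
  have : ∀ u, shiftDensity v s (u + s')
      = ENNReal.ofReal (Real.exp (s * s' / v)) * shiftDensity v s u := by
    intro u
    simp only [shiftDensity]
    rw [← ENNReal.ofReal_mul (by positivity), ← Real.exp_add]
    congr 2
    ring
  simp_rw [this]
  rw [lintegral_const_mul _ (measurable_shiftDensity v s), lintegral_shiftDensity hv, mul_one]

lemma lintegral_exp_mul_gaussianReal {v : ℝ≥0} (hv : v ≠ 0) (a : ℝ) :
    ∫⁻ u, ENNReal.ofReal (Real.exp (a * u)) ∂gaussianReal 0 v
      = ENNReal.ofReal (Real.exp (a ^ 2 * v / 2)) := by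
  have hv' : (v : ℝ) ≠ 0 := by exact_mod_cast hv
  have : ∀ u, ENNReal.ofReal (Real.exp (a * u))
      = ENNReal.ofReal (Real.exp (a ^ 2 * v / 2)) * shiftDensity v (a * v) u := by
    intro u
    simp only [shiftDensity]
    rw [← ENNReal.ofReal_mul (by positivity), ← Real.exp_add]
    congr 2
    field_simp
    ring
  simp_rw [this]
  rw [lintegral_const_mul _ (measurable_shiftDensity v _), lintegral_shiftDensity hv, mul_one]

lemma lintegral_exp_abs_gaussianReal_le {v : ℝ≥0} (hv : v ≠ 0) (a : ℝ) :
    ∫⁻ u, ENNReal.ofReal (Real.exp (a * |u|)) ∂gaussianReal 0 v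
      ≤ 2 * ENNReal.ofReal (Real.exp (a ^ 2 * v / 2)) := by
  calc ∫⁻ u, ENNReal.ofReal (Real.exp (a * |u|)) ∂gaussianReal 0 v
      ≤ ∫⁻ u, (ENNReal.ofReal (Real.exp (a * u)) + ENNReal.ofReal (Real.exp (-a * u)))
          ∂gaussianReal 0 v := by
        refine lintegral_mono fun u => ?_
        rcases abs_cases u with ⟨h, _⟩ | ⟨h, _⟩
        · rw [h]; exact le_self_add
        · rw [h, mul_neg, ← neg_mul]; exact le_add_self
    _ = _ := by
        rw [lintegral_add_left (by fun_prop), lintegral_exp_mul_gaussianReal hv,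
          lintegral_exp_mul_gaussianReal hv, two_mul, neg_sq]

lemma lintegral_exp_neg_mul_abs {a : ℝ} (ha : 0 < a) :
    ∫⁻ z : ℝ, ENNReal.ofReal (Real.exp (-a * |z|)) ≤ ENNReal.ofReal (2 / a) := by
  have hi : Integrable fun z : ℝ => Real.exp (-a * |z|) := by
    have h1 : IntegrableOn (fun z : ℝ => Real.exp (-a * |z|)) (Set.Ioi 0) :=
      (integrableOn_exp_mul_Ioi (by linarith : -a < 0) 0).congr_fun
        (fun z hz => by simp [abs_of_pos (Set.mem_Ioi.1 hz)]) measurableSet_Ioi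
    have h2 : IntegrableOn (fun z : ℝ => Real.exp (-a * |z|)) (Set.Iic 0) :=
      (integrableOn_exp_mul_Iic ha 0).congr_fun
        (fun z hz => by simp [abs_of_nonpos (Set.mem_Iic.1 hz)]) measurableSet_Iic
    rw [← integrableOn_univ, ← Set.Iic_union_Ioi (a := (0 : ℝ))]
    exact h2.union h1
  rw [← ofReal_integral_eq_lintegral_ofReal hi (.of_forall fun z => (Real.exp_pos _).le)]
  apply ENNReal.ofReal_le_ofReal
  rw [integral_comp_abs (f := fun z => Real.exp (-a * z)), integral_exp_mul_Ioi (by linarith)]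
  simp [div_eq_mul_inv]

lemma summable_exp_neg_abs_int : Summable fun m : ℤ => Real.exp (-|(m : ℝ)|) := by
  have h : Summable fun n : ℕ => Real.exp (-(n : ℝ)) := Real.summable_exp_neg_nat
  refine Summable.of_nat_of_neg ?_ ?_ <;> simpa using h

/-- Sums over a lattice translate of a Gaussian density are bounded uniformly in the translate. -/
lemma exists_tsum_gaussianPDF_le {v : ℝ≥0} (hv : v ≠ 0) :
    ∃ K : ℝ≥0, ∀ w : ℝ, ∑' k : ℤ, gaussianPDF 0 v (w - k) ≤ K := by
  have hv' : (0 : ℝ) < v := by exact_mod_cast pos_iff_ne_zero.2 hv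
  -- Translating the index by ⌊w⌋ makes |m| ≤ |y| + 1, and -y²/(2v) ≤ v/2 - |y| by completing the
  -- square. This produces the factor exp(v/2 + 1) and leaves the summable exp(-|m|).
  set A : ℝ := (√(2 * Real.pi * v))⁻¹ * Real.exp (v / 2 + 1) with hA
  have hA0 : 0 ≤ A := by positivity
  refine ⟨(A * ∑' m : ℤ, Real.exp (-|(m : ℝ)|)).toNNReal, fun w => ?_⟩
  change _ ≤ ENNReal.ofReal _
  rw [← tsum_mul_left, ENNReal.ofReal_tsum_of_nonneg (fun m => by positivity)
    (summable_exp_neg_abs_int.mul_left A),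
    ← (Equiv.addRight ⌊w⌋).tsum_eq fun k : ℤ => gaussianPDF 0 v (w - k)]
  refine ENNReal.tsum_le_tsum fun m => ENNReal.ofReal_le_ofReal ?_
  rw [gaussianPDFReal, hA, mul_assoc (√_)⁻¹, ← Real.exp_add]
  gcongr
  simp only [Equiv.coe_addRight, Int.cast_add, sub_zero]
  set y := w - ((m : ℝ) + ⌊w⌋) with hy
  have h1 : |(m : ℝ)| ≤ |y| + 1 := by
    have : (m : ℝ) = Int.fract w - y := by rw [Int.fract, hy]; ring
    rw [this]
    calc |Int.fract w - y| ≤ |Int.fract w| + |y| := abs_sub _ _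
      _ ≤ 1 + |y| := by
        gcongr
        rw [abs_of_nonneg (Int.fract_nonneg w)]
        exact (Int.fract_lt_one w).le
      _ = _ := add_comm _ _
  have h2 : -y ^ 2 / (2 * v) ≤ v / 2 - |y| := by
    rw [div_le_iff₀ (by positivity), ← sq_abs y]
    nlinarith [sq_nonneg (|y| - v)]
  linarith

/-- A perturbed one-dimensional lattice has bounded intensity, so the sum is at most a constant
times ∫ exp(-a|z|) dz = 2/a. The constant does not depend on `a`, so the bound becomes small for
large `a`. -/
lemma exists_tsum_lintegral_exp_le {v : ℝ≥0} (hv : v ≠ 0) :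
    ∃ K : ℝ≥0, ∀ a : ℝ, 0 < a → ∀ w : ℝ,
      ∑' k : ℤ, ∫⁻ y, ENNReal.ofReal (Real.exp (-a * |w - (k + y)|)) ∂gaussianReal 0 v
        ≤ K * ENNReal.ofReal (2 / a) := by
  obtain ⟨K, hK⟩ := exists_tsum_gaussianPDF_le hv
  refine ⟨K, fun a ha w => ?_⟩
  have h : ∀ k : ℤ, ∫⁻ y, ENNReal.ofReal (Real.exp (-a * |w - (k + y)|)) ∂gaussianReal 0 v
      = ∫⁻ z : ℝ, gaussianPDF 0 v (w - z - k) * ENNReal.ofReal (Real.exp (-a * |z|)) := by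
    intro k
    rw [lintegral_gaussianReal_eq hv (by fun_prop),
      ← lintegral_sub_left_eq_self _ (w - k)]
    refine lintegral_congr fun z => ?_
    rw [show w - k - z = w - z - k by ring, show w - (k + (w - z - k)) = z by ring]
  simp_rw [h]
  have hm : ∀ k : ℤ, Measurable fun z : ℝ => gaussianPDF 0 v (w - z - k) := fun k =>
    (measurable_gaussianPDF 0 v).comp (by fun_prop)
  rw [← lintegral_tsum fun k => by fun_prop]
  simp_rw [ENNReal.tsum_mul_right]
  calc _ ≤ ∫⁻ z : ℝ, K * ENNReal.ofReal (Real.exp (-a * |z|)) :=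
        lintegral_mono fun z => by gcongr; exact hK (w - z)
    _ ≤ _ := by
        rw [lintegral_const_mul _ (by fun_prop)]
        gcongr
        exact lintegral_exp_neg_mul_abs ha

lemma tsum_prod_pi {α : Type*} (n : ℕ) (f : Fin n → α → ℝ≥0∞) :
    ∑' x : Fin n → α, ∏ i, f i (x i) = ∏ i, ∑' a, f i a := by
  induction n with
  | zero => simp
  | succ n ih =>
    rw [Fin.prod_univ_succ, ← ih, ← (Fin.consEquiv fun _ : Fin (n + 1) => α).tsum_eq,
      ENNReal.tsum_prod', ← ENNReal.tsum_mul_right]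
    refine tsum_congr fun a => ?_
    rw [← ENNReal.tsum_mul_left]
    exact tsum_congr fun x => by simp [Fin.consEquiv, Fin.prod_univ_succ]

/-- The Gaussian measure `N_d(0, t² I)`. -/
noncomputable def isoGaussian (d : ℕ) (t : ℝ) : Measure (EuclideanSpace ℝ (Fin d)) :=
  multivariateGaussian 0 (t ^ 2 • (1 : Matrix (Fin d) (Fin d) ℝ))

instance (d : ℕ) (t : ℝ) : IsProbabilityMeasure (isoGaussian d t) := by
  unfold isoGaussian; infer_instance

variable {d : ℕ} {t : ℝ}

lemma isoGaussian_eq_map : isoGaussian d t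
    = (Measure.infinitePi fun _ : Fin d => gaussianReal 0 (t ^ 2).toNNReal).map (WithLp.toLp 2) := by
  have hpos : (t ^ 2 • (1 : Matrix (Fin d) (Fin d) ℝ)).PosSemidef :=
    Matrix.PosSemidef.one.smul (sq_nonneg t)
  rw [Measure.infinitePi_eq_pi]
  have : IsFiniteMeasure ((Measure.pi fun _ : Fin d => gaussianReal 0 (t ^ 2).toNNReal).map
      (WithLp.toLp 2)) := by infer_instance
  apply Measure.ext_of_charFun (E := EuclideanSpace ℝ (Fin d))
  ext x
  rw [isoGaussian, charFun_multivariateGaussian hpos, charFun_pi]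
  simp_rw [charFun_gaussianReal, ← Complex.exp_sum]
  congr 1
  simp [Matrix.smul_mulVec, dotProduct, Finset.sum_div,
    Real.coe_toNNReal _ (sq_nonneg t)]
  refine Finset.sum_congr rfl fun i _ => ?_
  ring

lemma lintegral_isoGaussian {g : EuclideanSpace ℝ (Fin d) → ℝ≥0∞} (hg : Measurable g) :
    ∫⁻ y, g y ∂isoGaussian d t
      = ∫⁻ y, g (WithLp.toLp 2 y) ∂Measure.infinitePi
        fun _ : Fin d => gaussianReal 0 (t ^ 2).toNNReal := by
  rw [isoGaussian_eq_map, lintegral_map hg (by fun_prop)]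

lemma lintegral_isoGaussian_prod {f : Fin d → ℝ → ℝ≥0∞} (hf : ∀ i, Measurable (f i)) :
    ∫⁻ y, ∏ i, f i (y i) ∂isoGaussian d t
      = ∏ i, ∫⁻ u, f i u ∂gaussianReal 0 (t ^ 2).toNNReal := by
  rw [lintegral_isoGaussian (g := fun y => ∏ i, f i (y i))
      (Finset.measurable_fun_prod _ fun j _ => (hf j).comp (by fun_prop)),
    ← lintegral_prod_coordinates _ _ hf]

/-- The density of the shift by `s` of `N_d(0, t² I)`. -/
noncomputable def isoShiftDensity (t : ℝ) (s y : EuclideanSpace ℝ (Fin d)) : ℝ≥0∞ :=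
  ∏ i, shiftDensity (t ^ 2).toNNReal (s i) (y i)

lemma measurable_isoShiftDensity (s : EuclideanSpace ℝ (Fin d)) :
    Measurable (isoShiftDensity t s) :=
  Finset.measurable_fun_prod _ fun j _ => (measurable_shiftDensity _ _).comp (by fun_prop)

lemma sq_toNNReal_ne_zero (ht : 0 < t) : (t ^ 2).toNNReal ≠ 0 := by
  simpa using ht.ne'

lemma lintegral_isoGaussian_add (ht : 0 < t) (s : EuclideanSpace ℝ (Fin d))
    {g : EuclideanSpace ℝ (Fin d) → ℝ≥0∞} (hg : Measurable g) :
    ∫⁻ y, g (y + s) ∂isoGaussian d t = ∫⁻ y, g y * isoShiftDensity t s y ∂isoGaussian d t := by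
  rw [lintegral_isoGaussian (g := fun y => g (y + s)) (by fun_prop),
    lintegral_isoGaussian (g := fun y => g y * isoShiftDensity t s y)
      (hg.mul (measurable_isoShiftDensity s))]
  have := lintegral_comp_piecewise (fun _ : Fin d => gaussianReal 0 (t ^ 2).toNNReal) Finset.univ
    (θ := fun i u => u + s i) (D := fun i => shiftDensity (t ^ 2).toNNReal (s i))
    (fun i => by fun_prop) (fun i => measurable_shiftDensity _ _)
    (fun i h hh => lintegral_gaussianReal_add (sq_toNNReal_ne_zero ht) (s i) hh)
    (f := fun y => g (WithLp.toLp 2 y)) (hg.comp (by fun_prop))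
  simp only [Finset.mem_univ, if_true] at this
  exact this

/-- The overlap of two Cameron-Martin densities is 1 when the shifts are orthogonal, in particular
when one of them vanishes. Sites that lie on only one of two paths therefore do not count in the
second moment. -/
lemma lintegral_isoShiftDensity_mul (ht : 0 < t) (s s' : EuclideanSpace ℝ (Fin d)) :
    ∫⁻ y, isoShiftDensity t s y * isoShiftDensity t s' y ∂isoGaussian d t
      = ENNReal.ofReal (Real.exp ((∑ i, s i * s' i) / t ^ 2)) := by
  simp_rw [isoShiftDensity, ← Finset.prod_mul_distrib]
  rw [lintegral_isoGaussian_prod (f := fun i u => shiftDensity (t ^ 2).toNNReal (s i) u *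
    shiftDensity (t ^ 2).toNNReal (s' i) u)
    fun i => (measurable_shiftDensity _ _).mul (measurable_shiftDensity _ _)]
  simp_rw [lintegral_shiftDensity_mul (sq_toNNReal_ne_zero ht)]
  rw [← ENNReal.ofReal_prod_of_nonneg fun i _ => (Real.exp_pos _).le, ← Real.exp_sum,
    Real.coe_toNNReal _ (sq_nonneg t), Finset.sum_div]

lemma ae_isoGaussian_add (ht : 0 < t) {p : EuclideanSpace ℝ (Fin d) → Prop}
    (hp : ∀ᵐ y ∂isoGaussian d t, p y) (s : EuclideanSpace ℝ (Fin d)) :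
    ∀ᵐ y ∂isoGaussian d t, p (y + s) := by
  have hN : isoGaussian d t (toMeasurable (isoGaussian d t) {y | ¬ p y}) = 0 := by
    rw [measure_toMeasurable]; exact hp
  set N := toMeasurable (isoGaussian d t) {y | ¬ p y}
  have hNm : MeasurableSet N := measurableSet_toMeasurable _ _
  have h := lintegral_isoGaussian_add ht s (g := N.indicator 1) (measurable_one.indicator hNm)
  have h0 : ∫⁻ y, N.indicator 1 y * isoShiftDensity t s y ∂isoGaussian d t = 0 := by
    refine lintegral_eq_zero_of_ae_eq_zero ?_
    filter_upwards [measure_eq_zero_iff_ae_notMem.1 hN] with y hy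
    simp [hy]
  rw [h0, lintegral_eq_zero_iff (by exact (measurable_one.indicator hNm).comp (by fun_prop))] at h
  filter_upwards [h] with y hy
  by_contra hpy
  have : y + s ∈ N := subset_toMeasurable _ _ hpy
  simp [this] at hy

lemma isoGaussian_singleton (hd : 0 < d) (ht : 0 < t) (y : EuclideanSpace ℝ (Fin d)) :
    isoGaussian d t {y} = 0 := by
  have := nullSingletonClass_gaussianReal (μ := 0) (sq_toNNReal_ne_zero ht)
  have hsub : ({y} : Set (EuclideanSpace ℝ (Fin d)))
      ⊆ (fun x : EuclideanSpace ℝ (Fin d) => x ⟨0, hd⟩) ⁻¹' {y ⟨0, hd⟩} := by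
    rintro _ rfl; rfl
  refine measure_mono_null hsub ?_
  rw [isoGaussian_eq_map, Measure.map_apply (by fun_prop)
    (measurableSet_singleton _ |>.preimage (by fun_prop))]
  have h2 := measurePreserving_eval_infinitePi
    (fun _ : Fin d => gaussianReal 0 (t ^ 2).toNNReal) ⟨0, hd⟩
  have h3 := h2.measure_preimage (measurableSet_singleton (y ⟨0, hd⟩)).nullMeasurableSet
  rw [measure_singleton] at h3
  exact h3

/-- The `ℓ¹` distance in Euclidean space. -/
def l1dist (x y : EuclideanSpace ℝ (Fin d)) : ℝ := ∑ i, |x i - y i|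

lemma l1dist_nonneg (x y : EuclideanSpace ℝ (Fin d)) : 0 ≤ l1dist x y :=
  Finset.sum_nonneg fun _ _ => abs_nonneg _

lemma measurable_l1dist {α : Type*} [MeasurableSpace α] {f g : α → EuclideanSpace ℝ (Fin d)}
    (hf : Measurable f) (hg : Measurable g) : Measurable fun a => l1dist (f a) (g a) := by
  unfold l1dist; fun_prop

/-- This factorization is the reason for measuring distances in ℓ¹: the Gaussian integrals split
into one-dimensional ones. -/
lemma ofReal_exp_mul_l1dist (a : ℝ) (x y : EuclideanSpace ℝ (Fin d)) :
    ENNReal.ofReal (Real.exp (a * l1dist x y))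
      = ∏ i, ENNReal.ofReal (Real.exp (a * |x i - y i|)) := by
  rw [l1dist, Finset.mul_sum, Real.exp_sum, ENNReal.ofReal_prod_of_nonneg fun i _ =>
    (Real.exp_pos _).le]

/-- The expected exponentially weighted number of points of a Gaussian perturbed lattice near a
point is small for fast decaying weights, uniformly in the point. -/
lemma exists_tsum_lintegral_l1dist_le (d : ℕ) (ht : 0 < t) :
    ∃ K : ℝ≥0, ∀ a : ℝ, 0 < a → ∀ u : EuclideanSpace ℝ (Fin d),
      ∑' x : Fin d → ℤ, ∫⁻ y, ENNReal.ofReal (Real.exp (-a * l1dist u (latticePoint x + y)))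
        ∂isoGaussian d t ≤ (K * ENNReal.ofReal (2 / a)) ^ d := by
  obtain ⟨K, hK⟩ := exists_tsum_lintegral_exp_le (sq_toNNReal_ne_zero ht)
  refine ⟨K, fun a ha u => ?_⟩
  have h : ∀ x : Fin d → ℤ,
      ∫⁻ y, ENNReal.ofReal (Real.exp (-a * l1dist u (latticePoint x + y))) ∂isoGaussian d t
        = ∏ i, ∫⁻ y, ENNReal.ofReal (Real.exp (-a * |u i - (x i + y)|))
          ∂gaussianReal 0 (t ^ 2).toNNReal := by
    intro x
    simp_rw [ofReal_exp_mul_l1dist]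
    rw [← lintegral_isoGaussian_prod fun i => by fun_prop]
    rfl
  simp_rw [h]
  rw [tsum_prod_pi d fun i (k : ℤ) => ∫⁻ y, ENNReal.ofReal (Real.exp (-a * |u i - (k + y)|))
          ∂gaussianReal 0 (t ^ 2).toNNReal]
  calc _ ≤ ∏ _i : Fin d, K * ENNReal.ofReal (2 / a) :=
        Finset.prod_le_prod' fun i _ => hK a ha (u i)
    _ = _ := by simp

/-- The bound depends on `a` and `t` only through their product. With t = 1/a the parameter `a` can
grow while the cost of the distance inside a pair stays constant. -/
lemma lintegral_exp_l1dist_le (ht : 0 < t) {a : ℝ} (ha : 0 < a) :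
    ∫⁻ y, ∫⁻ z, ENNReal.ofReal (Real.exp (a * l1dist y z)) ∂isoGaussian d t ∂isoGaussian d t
      ≤ (2 * ENNReal.ofReal (Real.exp (a ^ 2 * t ^ 2 / 2))) ^ (2 * d) := by
  have hle : ∀ y z : EuclideanSpace ℝ (Fin d), ENNReal.ofReal (Real.exp (a * l1dist y z))
      ≤ (∏ i, ENNReal.ofReal (Real.exp (a * |y i|))) *
        ∏ i, ENNReal.ofReal (Real.exp (a * |z i|)) := by
    intro y z
    rw [ofReal_exp_mul_l1dist, ← Finset.prod_mul_distrib]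
    refine Finset.prod_le_prod' fun i _ => ?_
    rw [← ENNReal.ofReal_mul (Real.exp_pos _).le, ← Real.exp_add, ← mul_add]
    gcongr
    exact abs_sub _ _
  have hm : Measurable fun z : EuclideanSpace ℝ (Fin d) =>
      ∏ i, ENNReal.ofReal (Real.exp (a * |z i|)) :=
    Finset.measurable_fun_prod _ fun i _ => by fun_prop
  have hI : ∫⁻ z, ∏ i, ENNReal.ofReal (Real.exp (a * |z i|)) ∂isoGaussian d t
      ≤ (2 * ENNReal.ofReal (Real.exp (a ^ 2 * t ^ 2 / 2))) ^ d := by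
    rw [lintegral_isoGaussian_prod (f := fun _ u => ENNReal.ofReal (Real.exp (a * |u|)))
      fun i => by fun_prop]
    calc _ ≤ ∏ _i : Fin d, 2 * ENNReal.ofReal (Real.exp (a ^ 2 * t ^ 2 / 2)) := by
          refine Finset.prod_le_prod' fun i _ => ?_
          have := lintegral_exp_abs_gaussianReal_le (sq_toNNReal_ne_zero ht) a
          rwa [Real.coe_toNNReal _ (sq_nonneg t)] at this
      _ = _ := by simp
  calc _ ≤ ∫⁻ y, ∫⁻ z, (∏ i, ENNReal.ofReal (Real.exp (a * |y i|))) *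
        ∏ i, ENNReal.ofReal (Real.exp (a * |z i|)) ∂isoGaussian d t ∂isoGaussian d t :=
        lintegral_mono fun y => lintegral_mono fun z => hle y z
    _ = (∫⁻ z, ∏ i, ENNReal.ofReal (Real.exp (a * |z i|)) ∂isoGaussian d t) *
        ∫⁻ z, ∏ i, ENNReal.ofReal (Real.exp (a * |z i|)) ∂isoGaussian d t := by
        simp_rw [lintegral_const_mul _ hm]
        rw [lintegral_mul_const _ hm]
    _ ≤ _ := by
        rw [two_mul d, pow_add]
        gcongr

end GaussianFacts

-- The field of displacements and the expected weight of chains of pairs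

section Field

open scoped ENNReal NNReal

/-- The data at one site: the common displacement and the two individual ones. -/
abbrev SiteData (d : ℕ) : Type := EuclideanSpace ℝ (Fin d) × (Fin 2 → EuclideanSpace ℝ (Fin d))

/-- The law of the displacements at one site. -/
noncomputable def siteLaw (d : ℕ) (t δ : ℝ) : Measure (SiteData d) :=
  (isoGaussian d t).prod (Measure.infinitePi fun _ : Fin 2 => isoGaussian d δ)

instance (d : ℕ) (t δ : ℝ) : IsProbabilityMeasure (siteLaw d t δ) := by
  unfold siteLaw; infer_instance

/-- The law of the field of all displacements. -/
noncomputable def fieldLaw (d : ℕ) (t δ : ℝ) : Measure ((Fin d → ℤ) → SiteData d) :=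
  Measure.infinitePi fun _ => siteLaw d t δ

instance (d : ℕ) (t δ : ℝ) : IsProbabilityMeasure (fieldLaw d t δ) := by
  unfold fieldLaw; infer_instance

variable {d : ℕ} {t δ : ℝ}

/-- The point with label `q`. -/
def fieldPoint (l : (Fin d → ℤ) → SiteData d) (q : (Fin d → ℤ) × Fin 2) :
    EuclideanSpace ℝ (Fin d) :=
  latticePoint q.1 + ((l q.1).1 + (l q.1).2 q.2)

lemma measurable_fieldPoint (q : (Fin d → ℤ) × Fin 2) :
    Measurable fun l : (Fin d → ℤ) → SiteData d => fieldPoint l q := by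
  unfold fieldPoint; fun_prop

lemma fieldPoint_update_of_ne {l : (Fin d → ℤ) → SiteData d} {x : Fin d → ℤ} {u : SiteData d}
    {q : (Fin d → ℤ) × Fin 2} (h : q.1 ≠ x) :
    fieldPoint (Function.update l x u) q = fieldPoint l q := by
  simp [fieldPoint, Function.update_of_ne h]

/-- The weight of a step from the pair of `q` to the pair of `p`, entering at `p` and leaving from
the partner of `q`. -/
noncomputable def stepWeight (a : ℝ) (l : (Fin d → ℤ) → SiteData d) (q p : (Fin d → ℤ) × Fin 2) :
    ℝ≥0∞ :=
  ENNReal.ofReal (Real.exp (a * l1dist (fieldPoint l p) (fieldPoint l (partner p))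
    + -a * l1dist (fieldPoint l (partner q)) (fieldPoint l p)))

lemma measurable_stepWeight (a : ℝ) (q p : (Fin d → ℤ) × Fin 2) :
    Measurable fun l => stepWeight a l q p := by
  unfold stepWeight
  have h1 := measurable_l1dist (measurable_fieldPoint p) (measurable_fieldPoint (partner p))
  have h2 := measurable_l1dist (measurable_fieldPoint (partner q)) (measurable_fieldPoint p)
  fun_prop

/-- The total weight of the chains of `k` steps from `q` that avoid the sites in `V`. -/
noncomputable def chainWeight (a : ℝ) (l : (Fin d → ℤ) → SiteData d) :
    ℕ → Finset (Fin d → ℤ) → (Fin d → ℤ) × Fin 2 → ℝ≥0∞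
  | 0, _, _ => 1
  | k + 1, V, q => ∑' p : (Fin d → ℤ) × Fin 2,
      if p.1 ∈ V then 0 else stepWeight a l q p * chainWeight a l k (insert p.1 V) p

lemma measurable_chainWeight (a : ℝ) (k : ℕ) (V : Finset (Fin d → ℤ))
    (q : (Fin d → ℤ) × Fin 2) : Measurable fun l => chainWeight a l k V q := by
  induction k generalizing V q with
  | zero => simp only [chainWeight]; exact measurable_const
  | succ k ih =>
    simp only [chainWeight]
    refine Measurable.tsum fun p => ?_
    split_ifs
    · exact measurable_const
    · exact (measurable_stepWeight a q p).mul (ih _ _)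

lemma l1dist_add_left (x y z : EuclideanSpace ℝ (Fin d)) : l1dist (x + y) (x + z) = l1dist y z := by
  simp [l1dist]

lemma lintegral_exp_within_le (hδ : 0 < δ) {a : ℝ} (ha : 0 < a) (i : Fin 2) :
    ∫⁻ f : Fin 2 → EuclideanSpace ℝ (Fin d),
      ENNReal.ofReal (Real.exp (a * l1dist (f i) (f i.rev)))
        ∂Measure.infinitePi (fun _ : Fin 2 => isoGaussian d δ)
      ≤ (2 * ENNReal.ofReal (Real.exp (a ^ 2 * δ ^ 2 / 2))) ^ (2 * d) := by
  have hi : i ≠ i.rev := by revert i; decide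
  have hmap := Measure.infinitePi_map_eval_prod (P := fun _ : Fin 2 => isoGaussian d δ) hi
  have hm : Measurable fun p : EuclideanSpace ℝ (Fin d) × EuclideanSpace ℝ (Fin d) =>
      ENNReal.ofReal (Real.exp (a * l1dist p.1 p.2)) := by
    have := measurable_l1dist (d := d) measurable_fst measurable_snd
    fun_prop
  have h := lintegral_exp_l1dist_le (d := d) hδ ha
  rw [← lintegral_prod (fun p : EuclideanSpace ℝ (Fin d) × EuclideanSpace ℝ (Fin d) =>
    ENNReal.ofReal (Real.exp (a * l1dist p.1 p.2))) hm.aemeasurable, ← hmap,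
    lintegral_map hm (by fun_prop)] at h
  exact h

/-- The expected total weight of the steps to a fresh site. -/
lemma exists_tsum_stepWeight_le (d : ℕ) (ht : 0 < t) :
    ∃ K : ℝ≥0, ∀ δ : ℝ, 0 < δ → ∀ a : ℝ, 0 < a → ∀ u : EuclideanSpace ℝ (Fin d),
      ∑' p : (Fin d → ℤ) × Fin 2, ∫⁻ s, ENNReal.ofReal (Real.exp (
          a * l1dist (latticePoint p.1 + (s.1 + s.2 p.2)) (latticePoint p.1 + (s.1 + s.2 p.2.rev))
          + -a * l1dist u (latticePoint p.1 + (s.1 + s.2 p.2)))) ∂siteLaw d t δ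
        ≤ 2 * ((K * ENNReal.ofReal (2 / a)) ^ d *
          (2 * ENNReal.ofReal (Real.exp (a ^ 2 * δ ^ 2 / 2))) ^ (2 * d)) := by
  obtain ⟨K, hK⟩ := exists_tsum_lintegral_l1dist_le d ht
  refine ⟨K, fun δ hδ a ha u => ?_⟩
  have key : ∀ i : Fin 2, ∑' x : Fin d → ℤ, ∫⁻ s, ENNReal.ofReal (Real.exp (
      a * l1dist (latticePoint x + (s.1 + s.2 i)) (latticePoint x + (s.1 + s.2 i.rev))
      + -a * l1dist u (latticePoint x + (s.1 + s.2 i)))) ∂siteLaw d t δ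
      ≤ (K * ENNReal.ofReal (2 / a)) ^ d *
          (2 * ENNReal.ofReal (Real.exp (a ^ 2 * δ ^ 2 / 2))) ^ (2 * d) := by
    intro i
    have h1 : ∀ x : Fin d → ℤ, ∫⁻ s, ENNReal.ofReal (Real.exp (
        a * l1dist (latticePoint x + (s.1 + s.2 i)) (latticePoint x + (s.1 + s.2 i.rev))
        + -a * l1dist u (latticePoint x + (s.1 + s.2 i)))) ∂siteLaw d t δ
        = ∫⁻ f : Fin 2 → EuclideanSpace ℝ (Fin d),
          ENNReal.ofReal (Real.exp (a * l1dist (f i) (f i.rev))) *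
            ∫⁻ y, ENNReal.ofReal (Real.exp (-a * l1dist (u - f i) (latticePoint x + y)))
              ∂isoGaussian d t ∂Measure.infinitePi (fun _ : Fin 2 => isoGaussian d δ) := by
      intro x
      have hm : Measurable fun s : SiteData d => ENNReal.ofReal (Real.exp (
          a * l1dist (latticePoint x + (s.1 + s.2 i)) (latticePoint x + (s.1 + s.2 i.rev))
          + -a * l1dist u (latticePoint x + (s.1 + s.2 i)))) := by
        have e1 := measurable_l1dist (d := d)
          (f := fun s : SiteData d => latticePoint x + (s.1 + s.2 i))
          (g := fun s : SiteData d => latticePoint x + (s.1 + s.2 i.rev)) (by fun_prop) (by fun_prop)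
        have e2 := measurable_l1dist (d := d) (f := fun _ : SiteData d => u)
          (g := fun s : SiteData d => latticePoint x + (s.1 + s.2 i)) (by fun_prop) (by fun_prop)
        fun_prop
      -- The distance inside the pair does not involve the common displacement, so integrating that
      -- displacement first decouples the two exponentials.
      rw [siteLaw, lintegral_prod_symm _ hm.aemeasurable]
      refine lintegral_congr fun f => ?_
      have hm2 : Measurable fun y : EuclideanSpace ℝ (Fin d) =>
          ENNReal.ofReal (Real.exp (-a * l1dist (u - f i) (latticePoint x + y))) := by
        have := measurable_l1dist (d := d) (f := fun _ => u - f i)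
          (g := fun y => latticePoint x + y) (by fun_prop) (by fun_prop)
        fun_prop
      rw [← lintegral_const_mul _ hm2]
      refine lintegral_congr fun y => ?_
      rw [← ENNReal.ofReal_mul (Real.exp_pos _).le, ← Real.exp_add]
      have c1 : l1dist (latticePoint x + (y + f i)) (latticePoint x + (y + f i.rev))
          = l1dist (f i) (f i.rev) := by rw [l1dist_add_left, l1dist_add_left]
      have c2 : l1dist u (latticePoint x + (y + f i))
          = l1dist (u - f i) (latticePoint x + y) := by
        simp only [l1dist]
        refine Finset.sum_congr rfl fun j _ => ?_
        congr 1
        simp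
        ring
      simp only [c1, c2]
    simp_rw [h1]
    rw [← lintegral_tsum fun x => ?_]
    · calc _ ≤ ∫⁻ f : Fin 2 → EuclideanSpace ℝ (Fin d),
            (K * ENNReal.ofReal (2 / a)) ^ d *
              ENNReal.ofReal (Real.exp (a * l1dist (f i) (f i.rev)))
              ∂Measure.infinitePi (fun _ : Fin 2 => isoGaussian d δ) := by
            refine lintegral_mono fun f => ?_
            rw [ENNReal.tsum_mul_left, mul_comm]
            gcongr
            exact hK a ha _
        _ ≤ _ := by
            have hm := measurable_l1dist (d := d)
              (f := fun f : Fin 2 → EuclideanSpace ℝ (Fin d) => f i) (g := fun f => f i.rev)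
              (by fun_prop) (by fun_prop)
            rw [lintegral_const_mul _ (by fun_prop)]
            gcongr
            exact lintegral_exp_within_le hδ ha i
    · refine Measurable.aemeasurable (Measurable.mul ?_ ?_)
      · have hm := measurable_l1dist (d := d)
          (f := fun f : Fin 2 → EuclideanSpace ℝ (Fin d) => f i) (g := fun f => f i.rev)
          (by fun_prop) (by fun_prop)
        fun_prop
      · refine Measurable.lintegral_prod_right' (f := fun p :
          (Fin 2 → EuclideanSpace ℝ (Fin d)) × EuclideanSpace ℝ (Fin d) =>
          ENNReal.ofReal (Real.exp (-a * l1dist (u - p.1 i) (latticePoint x + p.2)))) ?_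
        have hm := measurable_l1dist (d := d)
          (f := fun p : (Fin 2 → EuclideanSpace ℝ (Fin d)) × EuclideanSpace ℝ (Fin d) => u - p.1 i)
          (g := fun p => latticePoint x + p.2) (by fun_prop) (by fun_prop)
        fun_prop
  rw [← (Equiv.prodComm _ _).tsum_eq, ENNReal.tsum_prod', tsum_fintype, two_mul, Fin.sum_univ_two]
  exact add_le_add (key 0) (key 1)

/-- Each step enters a site outside `V`, whose data are independent of everything seen so far, so it
contributes a factor of at most `r`. The function `F` carries the weight of the steps already made,
which lets the induction run. -/
lemma lintegral_mul_chainWeight_le {a : ℝ} {r : ℝ≥0∞}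
    (hr : ∀ u : EuclideanSpace ℝ (Fin d), ∑' p : (Fin d → ℤ) × Fin 2, ∫⁻ s,
      ENNReal.ofReal (Real.exp (
          a * l1dist (latticePoint p.1 + (s.1 + s.2 p.2)) (latticePoint p.1 + (s.1 + s.2 p.2.rev))
          + -a * l1dist u (latticePoint p.1 + (s.1 + s.2 p.2)))) ∂siteLaw d t δ ≤ r)
    (k : ℕ) {V : Finset (Fin d → ℤ)} {q : (Fin d → ℤ) × Fin 2} (hq : q.1 ∈ V)
    {F : ((Fin d → ℤ) → SiteData d) → ℝ≥0∞} (hF : Measurable F)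
    (hinv : ∀ x ∉ V, ∀ l u, F (Function.update l x u) = F l) :
    ∫⁻ l, F l * chainWeight a l k V q ∂fieldLaw d t δ ≤ r ^ k * ∫⁻ l, F l ∂fieldLaw d t δ := by
  induction k generalizing V q F with
  | zero => simp [chainWeight]
  | succ k ih =>
    simp only [chainWeight, ← ENNReal.tsum_mul_left]
    let B : (Fin d → ℤ) × Fin 2 → ((Fin d → ℤ) → SiteData d) → ℝ≥0∞ := fun p l =>
      ∫⁻ s, ENNReal.ofReal (Real.exp (
          a * l1dist (latticePoint p.1 + (s.1 + s.2 p.2)) (latticePoint p.1 + (s.1 + s.2 p.2.rev))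
          + -a * l1dist (fieldPoint l (partner q)) (latticePoint p.1 + (s.1 + s.2 p.2))))
          ∂siteLaw d t δ
    rw [lintegral_tsum fun p => by
      refine (hF.mul ?_).aemeasurable
      split_ifs
      · exact measurable_const
      · exact (measurable_stepWeight a q p).mul (measurable_chainWeight a k _ p)]
    have hterm : ∀ p : (Fin d → ℤ) × Fin 2, ∫⁻ l, F l * (if p.1 ∈ V then 0 else
        stepWeight a l q p * chainWeight a l k (insert p.1 V) p) ∂fieldLaw d t δ
        ≤ r ^ k * ∫⁻ l, F l * B p l ∂fieldLaw d t δ := by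
      intro p
      split_ifs with hp
      · simp
      · have hqp : q.1 ≠ p.1 := fun h => hp (h ▸ hq)
        simp_rw [← mul_assoc]
        refine (ih (Finset.mem_insert_self _ _) (hF.mul (measurable_stepWeight a q p))
          fun x hx l u => ?_).trans ?_
        · simp only [Finset.mem_insert, not_or] at hx
          have h2 : q.1 ≠ x := fun h => hx.2 (h ▸ hq)
          simp only [Pi.mul_apply]
          rw [hinv x hx.2 l u, stepWeight, stepWeight, fieldPoint_update_of_ne (Ne.symm hx.1),
            fieldPoint_update_of_ne (q := partner p) (Ne.symm hx.1),
            fieldPoint_update_of_ne (q := partner q) h2]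
        · simp only [Pi.mul_apply]
          refine le_of_eq (congrArg (r ^ k * ·) ?_)
          refine (lintegral_mul_of_invariant (fun _ => siteLaw d t δ) p.1 hF
            (measurable_stepWeight a q p) (hinv p.1 hp)).trans ?_
          refine lintegral_congr fun l => ?_
          congr 1
          refine lintegral_congr fun s => ?_
          rw [stepWeight, fieldPoint_update_of_ne (q := partner q) hqp]
          simp [fieldPoint, partner]
    refine (ENNReal.tsum_le_tsum hterm).trans ?_
    rw [ENNReal.tsum_mul_left, pow_succ, mul_assoc]
    gcongr
    have hmeas : ∀ p : (Fin d → ℤ) × Fin 2, Measurable (B p) := by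
      intro p
      refine Measurable.lintegral_prod_right' (f := fun z :
        ((Fin d → ℤ) → SiteData d) × SiteData d => ENNReal.ofReal (Real.exp (
          a * l1dist (latticePoint p.1 + (z.2.1 + z.2.2 p.2))
            (latticePoint p.1 + (z.2.1 + z.2.2 p.2.rev))
          + -a * l1dist (fieldPoint z.1 (partner q))
            (latticePoint p.1 + (z.2.1 + z.2.2 p.2))))) ?_
      have hf : Measurable fun z : ((Fin d → ℤ) → SiteData d) × SiteData d =>
          latticePoint p.1 + (z.2.1 + z.2.2 p.2) := by fun_prop
      have e1 := measurable_l1dist hf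
        (g := fun z : ((Fin d → ℤ) → SiteData d) × SiteData d =>
          latticePoint p.1 + (z.2.1 + z.2.2 p.2.rev)) (by fun_prop)
      have e2 := measurable_l1dist
        ((measurable_fieldPoint (d := d) (partner q)).comp measurable_fst) hf
      simp only [Function.comp_apply] at e2
      fun_prop
    rw [← lintegral_tsum (f := fun p l => F l * B p l)
      fun p => (hF.mul (hmeas p)).aemeasurable, ← lintegral_const_mul _ hF]
    refine lintegral_mono fun l => ?_
    simp only
    rw [ENNReal.tsum_mul_left, mul_comm]
    gcongr
    exact hr _

lemma prod_stepWeight_le_chainWeight (a : ℝ) (l : (Fin d → ℤ) → SiteData d) (k : ℕ)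
    (V : Finset (Fin d → ℤ)) (ch : ℕ → (Fin d → ℤ) × Fin 2)
    (hch : Function.Injective fun n => (ch n).1) (hV : ∀ n, (ch (n + 1)).1 ∉ V) :
    ∏ j ∈ Finset.range k, stepWeight a l (ch j) (ch (j + 1)) ≤ chainWeight a l k V (ch 0) := by
  induction k generalizing V ch with
  | zero => simp [chainWeight]
  | succ k ih =>
    rw [Finset.prod_range_succ', mul_comm, chainWeight]
    refine le_trans ?_ (ENNReal.le_tsum (ch 1))
    rw [if_neg (hV 0)]
    gcongr
    refine ih (insert (ch 1).1 V) (fun n => ch (n + 1)) (fun m n h => ?_) fun n => ?_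
    · exact Nat.succ_injective (hch h)
    · rw [Finset.mem_insert, not_or]
      exact ⟨fun h => by simpa using hch h, hV (n + 1)⟩

/-- Every chain is one term of the total weight, so its own weight exp(a(inside - between)) tends to
0. The weight omits the inside distance of the first pair; waiting until it falls below exp(-a ·
that distance) makes up for this. -/
lemma isShortPairing_of_chainWeight {a : ℝ} (ha : 0 < a) {l : (Fin d → ℤ) → SiteData d}
    (h : ∀ q : (Fin d → ℤ) × Fin 2,
      Filter.Tendsto (fun k => chainWeight a l k {q.1} q) Filter.atTop (nhds 0)) :
    IsShortPairing l1dist (fieldPoint l) := by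
  intro ch hch
  have hpos : (0 : ℝ≥0∞) < ENNReal.ofReal (Real.exp (-a *
      l1dist (fieldPoint l (ch 0)) (fieldPoint l (partner (ch 0))))) :=
    ENNReal.ofReal_pos.2 (Real.exp_pos _)
  filter_upwards [(h (ch 0)).eventually_lt_const hpos] with k hk
  have hle := (prod_stepWeight_le_chainWeight a l k {(ch 0).1} ch hch fun n => by
    rw [Finset.mem_singleton]
    exact fun h => by simpa using hch h).trans_lt hk
  simp only [stepWeight] at hle
  rw [← ENNReal.ofReal_prod_of_nonneg fun j _ => (Real.exp_pos _).le, ← Real.exp_sum,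
    ENNReal.ofReal_lt_ofReal_iff (Real.exp_pos _), Real.exp_lt_exp, Finset.sum_add_distrib,
    ← Finset.mul_sum, ← Finset.mul_sum] at hle
  rw [Finset.sum_range_succ']
  nlinarith

/-- For small `δ` the pairs of the field form a short pairing. -/
lemma exists_ae_isShortPairing (hd : 0 < d) (ht : 0 < t) :
    ∃ δ : ℝ, 0 < δ ∧ ∀ᵐ l ∂fieldLaw d t δ, IsShortPairing l1dist (fieldPoint l) := by
  obtain ⟨K, hK⟩ := exists_tsum_stepWeight_le d ht
  set M : ℝ := (2 * Real.exp (1 / 2)) ^ (2 * d) with hM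
  have hM1 : 1 ≤ M := one_le_pow₀ (by linarith [Real.add_one_le_exp (1 / 2 : ℝ)])
  -- With this `a` one has K · 2/a ≤ 1/(4M), and δ = 1/a keeps a²δ² = 1, so that `M` bounds the
  -- exponential moment inside a pair. The steps then weigh at most 2 · (1/(4M)) · M = 1/2.
  set a : ℝ := 8 * (K + 1) * M with ha_def
  have hKn : (0 : ℝ) ≤ K := K.2
  have ha : 0 < a := by positivity
  refine ⟨1 / a, by positivity, ?_⟩
  have hr : 2 * (((K : ℝ≥0∞) * ENNReal.ofReal (2 / a)) ^ d *
      (2 * ENNReal.ofReal (Real.exp (a ^ 2 * (1 / a) ^ 2 / 2))) ^ (2 * d)) ≤ 2⁻¹ := by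
    have e1 : (K : ℝ≥0∞) * ENNReal.ofReal (2 / a) = ENNReal.ofReal (K * (2 / a)) := by
      rw [ENNReal.ofReal_mul hKn, ENNReal.ofReal_coe_nnreal]
    have e2 : (K : ℝ) * (2 / a) ≤ 1 / (4 * M) := by
      rw [ha_def, ← sub_nonneg]
      have : 1 / (4 * M) - K * (2 / (8 * (K + 1) * M)) = 1 / (4 * (K + 1) * M) := by
        field_simp
        ring
      rw [this]
      positivity
    have e3 : a ^ 2 * (1 / a) ^ 2 / 2 = 1 / 2 := by field_simp
    have e4 : (2 : ℝ≥0∞) = ENNReal.ofReal 2 := by simp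
    have e5 : (2 : ℝ≥0∞)⁻¹ = ENNReal.ofReal (1 / 2) := by
      rw [one_div, ENNReal.ofReal_inv_of_pos two_pos]; simp
    have h0 : (0 : ℝ) ≤ K * (2 / a) := by positivity
    rw [e1, e3, e5, e4, ← ENNReal.ofReal_mul two_pos.le, ← ENNReal.ofReal_pow h0,
      ← ENNReal.ofReal_pow (by positivity), ← hM, ← ENNReal.ofReal_mul (by positivity),
      ← ENNReal.ofReal_mul two_pos.le]
    apply ENNReal.ofReal_le_ofReal
    have e6 : (K * (2 / a)) ^ d ≤ 1 / (4 * M) := by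
      refine le_trans (pow_le_of_le_one h0 (e2.trans ?_) hd.ne') e2
      rw [div_le_one (by positivity)]
      linarith
    calc 2 * ((K * (2 / a)) ^ d * M) ≤ 2 * (1 / (4 * M) * M) := by gcongr
      _ = 1 / 2 := by field_simp; norm_num
  have hexp : ∀ q : (Fin d → ℤ) × Fin 2, ∀ᵐ l ∂fieldLaw d t (1 / a),
      Filter.Tendsto (fun k => chainWeight a l k {q.1} q) Filter.atTop (nhds 0) := by
    intro q
    have hb : ∀ k, ∫⁻ l, chainWeight a l k {q.1} q ∂fieldLaw d t (1 / a) ≤ 2⁻¹ ^ k := by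
      intro k
      have := lintegral_mul_chainWeight_le (fun u => (hK (1 / a) (by positivity) a ha u).trans hr)
        k (Finset.mem_singleton_self q.1) (F := fun _ => 1) measurable_const (fun _ _ _ _ => rfl)
      simpa using this
    have hsum : ∫⁻ l, ∑' k, chainWeight a l k {q.1} q ∂fieldLaw d t (1 / a) ≠ ⊤ := by
      rw [lintegral_tsum fun k => (measurable_chainWeight a k _ q).aemeasurable]
      refine ne_top_of_le_ne_top ?_ (ENNReal.tsum_le_tsum hb)
      rw [ENNReal.tsum_geometric, ENNReal.one_sub_inv_two, inv_inv]
      exact ENNReal.ofNat_ne_top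
    filter_upwards [ae_lt_top (Measurable.tsum fun k => measurable_chainWeight a k _ q)
      hsum] with l hl
    exact ENNReal.tendsto_atTop_zero_of_tsum_ne_top hl.ne
  filter_upwards [ae_all_iff.2 hexp] with l hl
  exact isShortPairing_of_chainWeight ha hl

end Field

-- A Lipschitz lattice path that is hard to predict

section UnpredictablePath

open scoped ENNReal NNReal unitInterval

/-- The randomness driving a path with two coordinates: one uniform variable for each coordinate,
scale and block of times. -/
abbrev PathNoise : Type := Fin 2 × ℕ × ℕ → I

noncomputable def noiseLaw : Measure PathNoise := Measure.infinitePi fun _ => volume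

instance : IsProbabilityMeasure noiseLaw := by unfold noiseLaw; infer_instance

/-- The velocity at time `t` is a superposition of the velocities of all scales. -/
noncomputable def pathVelocity (r : PathNoise) (i : Fin 2) (t : ℕ) : ℝ :=
  ∑' j : ℕ, (1 / 2 : ℝ) ^ j * r (i, j, t / 16 ^ j)

noncomputable def pathPosition (r : PathNoise) (i : Fin 2) (n : ℕ) : ℝ :=
  ∑ t ∈ Finset.range n, pathVelocity r i t

noncomputable def pathCoord (r : PathNoise) (i : Fin 2) (n : ℕ) : ℤ := ⌊pathPosition r i n⌋

lemma summable_pathVelocity (r : PathNoise) (i : Fin 2) (t : ℕ) :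
    Summable fun j : ℕ => (1 / 2 : ℝ) ^ j * r (i, j, t / 16 ^ j) :=
  Summable.of_nonneg_of_le (fun j => mul_nonneg (by positivity) (r _).2.1)
    (fun j => mul_le_of_le_one_right (by positivity) (r _).2.2) summable_geometric_two

lemma pathVelocity_nonneg (r : PathNoise) (i : Fin 2) (t : ℕ) : 0 ≤ pathVelocity r i t :=
  tsum_nonneg fun _ => mul_nonneg (by positivity) (r _).2.1

lemma pathVelocity_le (r : PathNoise) (i : Fin 2) (t : ℕ) : pathVelocity r i t ≤ 2 := by
  rw [← tsum_geometric_two]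
  exact (summable_pathVelocity r i t).tsum_le_tsum
    (fun j => mul_le_of_le_one_right (by positivity) (r _).2.2) summable_geometric_two

lemma measurable_pathCoord (i : Fin 2) (n : ℕ) : Measurable fun r => pathCoord r i n := by
  unfold pathCoord pathPosition pathVelocity
  refine Int.measurable_floor.comp (Finset.measurable_fun_sum _ fun t _ => ?_)
  refine Measurable.tsum fun j => ?_
  fun_prop

lemma pathCoord_zero (r : PathNoise) (i : Fin 2) : pathCoord r i 0 = 0 := by
  simp [pathCoord, pathPosition]

lemma abs_pathCoord_succ_sub_le (r : PathNoise) (i : Fin 2) (n : ℕ) :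
    |pathCoord r i (n + 1) - pathCoord r i n| ≤ 2 := by
  have h1 : pathPosition r i (n + 1) = pathPosition r i n + pathVelocity r i n :=
    Finset.sum_range_succ _ _
  have h2 := pathVelocity_nonneg r i n
  have h3 := pathVelocity_le r i n
  have h4 : pathCoord r i n ≤ pathCoord r i (n + 1) := Int.floor_le_floor (by linarith)
  have h5 : pathCoord r i (n + 1) ≤ pathCoord r i n + 2 := by
    unfold pathCoord
    rw [← Int.floor_add_ofNat]
    exact Int.floor_le_floor (by rw [h1]; simpa using h3)
  rw [abs_le]
  omega

lemma pathVelocity_update (r : PathNoise) (i : Fin 2) (j b : ℕ) (u : I) (t : ℕ) :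
    pathVelocity (Function.update r (i, j, b) u) i t
      = pathVelocity (Function.update r (i, j, b) 0) i t
        + if t / 16 ^ j = b then (1 / 2 : ℝ) ^ j * u else 0 := by
  unfold pathVelocity
  rw [(summable_pathVelocity _ i t).tsum_eq_add_tsum_ite j,
    (summable_pathVelocity (Function.update r (i, j, b) 0) i t).tsum_eq_add_tsum_ite j]
  have hrest : ∀ k, (if k = j then 0 else
      (1 / 2 : ℝ) ^ k * (Function.update r (i, j, b) u (i, k, t / 16 ^ k) : ℝ))
      = if k = j then 0 else
        (1 / 2 : ℝ) ^ k * (Function.update r (i, j, b) 0 (i, k, t / 16 ^ k) : ℝ) := by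
    intro k
    split_ifs with hk
    · rfl
    · rw [Function.update_of_ne (by simp [hk]), Function.update_of_ne (by simp [hk])]
  simp_rw [hrest]
  split_ifs with hb
  · subst hb; simp; ring
  · rw [Function.update_of_ne (by simp [hb]), Function.update_of_ne (by simp [hb]), add_zero]

lemma pathCoord_update_of_ne (r : PathNoise) {i i' : Fin 2} (h : i ≠ i') (k : ℕ × ℕ) (u : I)
    (n : ℕ) : pathCoord (Function.update r (i', k) u) i n = pathCoord r i n := by
  unfold pathCoord pathPosition pathVelocity
  simp [Function.update_of_ne, h]

/-- Adaptedness without filtrations: what depends only on the path up to time `n` is invariant under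
changing the noise of blocks that begin at `n` or later. -/
lemma pathCoord_update_of_le (r : PathNoise) (i i' : Fin 2) {j b n : ℕ} (h : n ≤ b * 16 ^ j)
    (u : I) : pathCoord (Function.update r (i', j, b) u) i n = pathCoord r i n := by
  unfold pathCoord pathPosition pathVelocity
  congr 1
  refine Finset.sum_congr rfl fun t ht => tsum_congr fun k => ?_
  rw [Function.update_of_ne]
  rintro heq
  simp only [Prod.mk.injEq] at heq
  obtain ⟨_, rfl, hb⟩ := heq
  have h1 := Nat.div_mul_le_self t (16 ^ k)
  rw [hb] at h1
  have := Finset.mem_range.1 ht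
  omega

/-- A completed block of scale `j` lasts 16^j time units at speed 2^(-j) u, and so contributes 8^j
u. Thus speeds stay summable while displacements spread over a distance of order (time)^(3/4). -/
lemma pathPosition_update (r : PathNoise) (i : Fin 2) {j b n : ℕ} (h : (b + 1) * 16 ^ j ≤ n)
    (u : I) : pathPosition (Function.update r (i, j, b) u) i n
      = pathPosition (Function.update r (i, j, b) 0) i n + 8 ^ j * u := by
  unfold pathPosition
  simp_rw [pathVelocity_update r i j b u]
  rw [Finset.sum_add_distrib, ← Finset.sum_filter, Finset.sum_const]
  have : (Finset.range n).filter (fun t => t / 16 ^ j = b)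
      = Finset.Ico (b * 16 ^ j) ((b + 1) * 16 ^ j) := by
    ext t
    simp only [Finset.mem_filter, Finset.mem_range, Finset.mem_Ico]
    have hp : 0 < 16 ^ j := by positivity
    constructor
    · rintro ⟨_, rfl⟩
      exact ⟨Nat.div_mul_le_self _ _, by rw [mul_comm]; exact Nat.lt_mul_div_succ t hp⟩
    · rintro ⟨h1, h2⟩
      exact ⟨h2.trans_le h, Nat.div_eq_of_lt_le h1 h2⟩
  rw [this, Nat.card_Ico, ← Nat.sub_mul, Nat.add_sub_cancel_left, one_mul, nsmul_eq_mul, ← mul_assoc]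
  push_cast
  rw [← mul_pow]
  norm_num

lemma volume_affine_floor_eq_le (c L : ℝ) (hL : 0 < L) (a : ℤ) :
    (volume : Measure I) {u : I | ⌊c + L * (u : ℝ)⌋ = a} ≤ ENNReal.ofReal (1 / L) := by
  have hsub : ((↑) : I → ℝ) '' {u : I | ⌊c + L * (u : ℝ)⌋ = a}
      ⊆ Set.Ico ((a - c) / L) ((a + 1 - c) / L) := by
    rintro _ ⟨u, hu, rfl⟩
    have hu' := Int.floor_eq_iff.1 hu
    constructor
    · rw [div_le_iff₀ hL]; linarith [hu'.1]
    · rw [lt_div_iff₀ hL]; linarith [hu'.2]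
  rw [unitInterval.volume_apply]
  refine (measure_mono hsub).trans ?_
  rw [Real.volume_Ico]
  apply ENNReal.ofReal_le_ofReal
  rw [← sub_div]
  apply le_of_eq
  ring

/-- The bound for the conditional probability of a given value after a time `k`. -/
noncomputable def predictability (k : ℕ) : ℝ≥0∞ := ENNReal.ofReal ((1 / 8) ^ Nat.log 16 (k / 2))

/-- Freeze all noise except that of one block of scale j inside [m, n], with j maximal such that 2 ·
16^j ≤ n - m. The position at time n is then c + 8^j u with u uniform, and it has a given integer
part with probability at most 8^(-j). -/
lemma lintegral_mul_pathCoord_le {m n : ℕ} (i : Fin 2) {f : PathNoise → ℝ≥0∞}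
    (hf : Measurable f)
    (hinv : ∀ j b, m ≤ b * 16 ^ j → ∀ r u, f (Function.update r (i, j, b) u) = f r) (a : ℤ) :
    ∫⁻ r, f r * (if pathCoord r i n = a then 1 else 0) ∂noiseLaw
      ≤ predictability (n - m) * ∫⁻ r, f r ∂noiseLaw := by
  have hm : Measurable fun r : PathNoise => if pathCoord r i n = a then (1 : ℝ≥0∞) else 0 :=
    Measurable.ite (measurable_pathCoord i n (measurableSet_singleton a)) measurable_const
      measurable_const
  rcases Nat.eq_zero_or_pos ((n - m) / 2) with h0 | hpos
  · rw [predictability, h0]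
    simp only [Nat.log_zero_right, pow_zero, ENNReal.ofReal_one, one_mul]
    exact lintegral_mono fun r => mul_le_of_le_one_right' (by split_ifs <;> simp)
  · set j := Nat.log 16 ((n - m) / 2) with hj
    have hj2 : 2 * 16 ^ j ≤ n - m := by
      have := Nat.pow_log_le_self 16 hpos.ne'
      rw [← hj] at this
      omega
    have hp : 0 < 16 ^ j := by positivity
    -- The first block of scale `j` that begins after time `m`; it is finished by time `n` because n
    -- - m is at least two block lengths.
    set b := m / 16 ^ j + 1 with hb
    have hb1 : m ≤ b * 16 ^ j := by
      have := Nat.lt_mul_div_succ m hp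
      rw [hb]; linarith
    have hb2 : (b + 1) * 16 ^ j ≤ n := by
      have := Nat.div_mul_le_self m (16 ^ j)
      have h3 : (b + 1) * 16 ^ j = m / 16 ^ j * 16 ^ j + 2 * 16 ^ j := by rw [hb]; ring
      omega
    refine lintegral_mul_le_of_invariant (fun _ => volume) (i, j, b) hf hm
      (fun r u => hinv j b hb1 r u) fun r => ?_
    have hset : ∀ u : I, (if pathCoord (Function.update r (i, j, b) u) i n = a
        then (1 : ℝ≥0∞) else 0) = Set.indicator
          {u : I | ⌊pathPosition (Function.update r (i, j, b) 0) i n + 8 ^ j * (u : ℝ)⌋ = a} 1 u := by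
      intro u
      rw [pathCoord, pathPosition_update r i hb2 u, Set.indicator_apply]
      rfl
    simp_rw [hset]
    refine (lintegral_indicator_one_le _).trans ?_
    refine (volume_affine_floor_eq_le _ _ (by positivity) a).trans (le_of_eq ?_)
    rw [predictability, ← hj, one_div_pow]

/-- The two coordinates are driven by disjoint families of noise, so the bounds multiply. One
coordinate would not suffice: k^(-3/4) is not summable, while its square k^(-3/2) is. -/
lemma lintegral_mul_pathCoord_pair_le {m n : ℕ} {f : PathNoise → ℝ≥0∞} (hf : Measurable f)
    (hinv : ∀ i j b, m ≤ b * 16 ^ j → ∀ r u, f (Function.update r (i, j, b) u) = f r)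
    (a : Fin 2 → ℤ) :
    ∫⁻ r, f r * (if ∀ i, pathCoord r i n = a i then 1 else 0) ∂noiseLaw
      ≤ predictability (n - m) ^ 2 * ∫⁻ r, f r ∂noiseLaw := by
  have hsplit : ∀ r : PathNoise, f r * (if ∀ i, pathCoord r i n = a i then (1 : ℝ≥0∞) else 0)
      = (f r * (if pathCoord r 0 n = a 0 then 1 else 0)) *
        (if pathCoord r 1 n = a 1 then 1 else 0) := by
    intro r
    simp only [Fin.forall_fin_two]
    split_ifs <;> simp_all
  have hm : Measurable fun r : PathNoise => if pathCoord r 0 n = a 0 then (1 : ℝ≥0∞) else 0 :=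
    Measurable.ite (measurable_pathCoord 0 n (measurableSet_singleton _)) measurable_const
      measurable_const
  simp_rw [hsplit]
  refine (lintegral_mul_pathCoord_le (m := m) 1 (hf.mul hm) (fun j b hb r u => ?_) (a 1)).trans ?_
  · simp only [Pi.mul_apply]
    rw [hinv 1 j b hb, pathCoord_update_of_ne r (by decide)]
  · rw [sq, mul_assoc]
    gcongr
    exact lintegral_mul_pathCoord_le (m := m) 0 hf (hinv 0) (a 0)

lemma tsum_predictability_sq_ne_top : ∑' k, predictability k ^ 2 ≠ ⊤ := by
  have hb : ∀ k : ℕ, ((1 / 8 : ℝ) ^ Nat.log 16 (k / 2)) ^ 2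
      ≤ (32 : ℝ) ^ (3 / 2 : ℝ) * (1 / ((k : ℝ) + 1) ^ (3 / 2 : ℝ)) := by
    intro k
    set L := Nat.log 16 (k / 2)
    have h1 : k / 2 < 16 ^ (L + 1) := Nat.lt_pow_succ_log_self (by norm_num) _
    have h2 : k + 1 ≤ 32 * 16 ^ L := by rw [pow_succ] at h1; omega
    have h3 : ((k : ℝ) + 1) ≤ 32 * 16 ^ L := by exact_mod_cast h2
    have h4 : ((k : ℝ) + 1) ^ (3 / 2 : ℝ) ≤ 32 ^ (3 / 2 : ℝ) * 64 ^ L := by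
      calc ((k : ℝ) + 1) ^ (3 / 2 : ℝ) ≤ (32 * 16 ^ L) ^ (3 / 2 : ℝ) :=
            Real.rpow_le_rpow (by positivity) h3 (by norm_num)
        _ = 32 ^ (3 / 2 : ℝ) * 64 ^ L := by
            rw [Real.mul_rpow (by norm_num) (by positivity), ← Real.rpow_natCast 16 L,
              ← Real.rpow_mul (by norm_num), mul_comm (L : ℝ), Real.rpow_mul (by norm_num),
              Real.rpow_natCast]
            congr 2
            rw [show (16 : ℝ) = 4 ^ (2 : ℝ) by norm_num, ← Real.rpow_mul (by norm_num)]
            norm_num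
    have h5 : (0 : ℝ) < ((k : ℝ) + 1) ^ (3 / 2 : ℝ) := by positivity
    rw [← pow_mul, mul_comm L 2, pow_mul, mul_one_div, le_div_iff₀ h5]
    calc ((1 / 8 : ℝ) ^ 2) ^ L * ((k : ℝ) + 1) ^ (3 / 2 : ℝ)
        ≤ ((1 / 8 : ℝ) ^ 2) ^ L * (32 ^ (3 / 2 : ℝ) * 64 ^ L) := by gcongr
      _ = 32 ^ (3 / 2 : ℝ) * (((1 / 8 : ℝ) ^ 2) ^ L * 64 ^ L) := by ring
      _ = _ := by rw [← mul_pow]; norm_num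
  have hs : Summable fun k : ℕ => (32 : ℝ) ^ (3 / 2 : ℝ) * (1 / ((k : ℝ) + 1) ^ (3 / 2 : ℝ)) := by
    refine Summable.mul_left _ ?_
    have := (summable_nat_add_iff 1).2
      (Real.summable_one_div_nat_rpow.2 (by norm_num : (1 : ℝ) < 3 / 2))
    simpa using this
  have hs' := Summable.of_nonneg_of_le (fun k => by positivity) hb hs
  have : ∀ k, predictability k ^ 2
      = ENNReal.ofReal (((1 / 8 : ℝ) ^ Nat.log 16 (k / 2)) ^ 2) := fun k => by
    rw [predictability, ← ENNReal.ofReal_pow (by positivity)]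
  simp_rw [this]
  exact hs'.tsum_ofReal_ne_top

/-- The number of meetings of the random path with any fixed path has a small exponential
moment. -/
lemma lintegral_prod_meeting_le {ε : ℝ≥0∞} (hε : ε * ∑' k, predictability k ^ 2 ≤ 2⁻¹)
    (hε1 : ε ≤ 1) (a : ℕ → Fin 2 → ℤ) (N : ℕ) :
    ∫⁻ r, ∏ n ∈ Finset.range N, (1 + ε * if ∀ i, pathCoord r i n = a n i then 1 else 0)
      ∂noiseLaw ≤ 2 := by
  set J : ℕ → PathNoise → ℝ≥0∞ := fun n r => if ∀ i, pathCoord r i n = a n i then 1 else 0 with hJ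
  set W : ℕ → PathNoise → ℝ≥0∞ := fun n r => ∏ m ∈ Finset.range n, (1 + ε * J m r) with hW
  have hJm : ∀ n, Measurable (J n) := fun n => by
    refine Measurable.ite ?_ measurable_const measurable_const
    have : {r : PathNoise | ∀ i, pathCoord r i n = a n i}
        = ⋂ i, (fun r => pathCoord r i n) ⁻¹' {a n i} := by ext; simp
    rw [this]
    exact MeasurableSet.iInter fun i => measurable_pathCoord i n (measurableSet_singleton _)
  have hWm : ∀ n, Measurable (W n) := fun n =>
    Finset.measurable_fun_prod _ fun m _ => measurable_const.add (measurable_const.mul (hJm m))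
  have hJinv : ∀ n i j b, n ≤ b * 16 ^ j → ∀ r u, J n (Function.update r (i, j, b) u) = J n r := by
    intro n i j b hb r u
    simp only [hJ, pathCoord_update_of_le r _ i hb u]
  have hWinv : ∀ n i j b, n ≤ b * 16 ^ j → ∀ r u, W n (Function.update r (i, j, b) u) = W n r := by
    intro n i j b hb r u
    refine Finset.prod_congr rfl fun m hm => ?_
    rw [hJinv m i j b ((Finset.mem_range.1 hm).le.trans hb)]
  -- The product is expanded according to its last meeting.
  have hWsum : ∀ n r, W n r = 1 + ε * ∑ m ∈ Finset.range n, J m r * W m r := by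
    intro n r
    induction n with
    | zero => simp [hW]
    | succ n ih =>
      rw [Finset.sum_range_succ, mul_add, ← add_assoc, ← ih]
      simp only [hW, Finset.prod_range_succ]
      ring
  have hJ1 : ∀ n r, J n r ≤ 1 := fun n r => by simp only [hJ]; split_ifs <;> simp
  set α : ℕ → ℝ≥0∞ := fun n => ∫⁻ r, J n r * W n r ∂noiseLaw with hα
  set ψ : ℕ → ℝ≥0∞ := fun k => predictability k ^ 2
  set Ψ := ∑' k, ψ k
  have hJWm : ∀ m, Measurable fun r => J m r * W m r := fun m => (hJm m).mul (hWm m)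
  -- A renewal inequality: J m · W m depends only on the path up to time `m`, so a meeting at `n`
  -- costs a further factor ψ(n - m).
  have hrec : ∀ n, α n ≤ ψ n + ε * ∑ m ∈ Finset.range n, ψ (n - m) * α m := by
    intro n
    have h1 : α n = ∫⁻ r, (J n r + ε * ∑ m ∈ Finset.range n, (J m r * W m r) * J n r)
        ∂noiseLaw := by
      refine lintegral_congr fun r => ?_
      rw [hWsum n r, ← Finset.sum_mul]
      ring
    have hJWJm : ∀ m, Measurable fun r => J m r * W m r * J n r := fun m => (hJWm m).mul (hJm n)
    rw [h1, lintegral_add_left (hJm n), lintegral_const_mul _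
      (Finset.measurable_fun_sum _ fun m _ => hJWJm m),
      lintegral_finsetSum _ fun m _ => hJWJm m]
    gcongr with m hm
    · have := lintegral_mul_pathCoord_pair_le (m := 0) (n := n) (f := fun _ => 1) measurable_const
        (fun _ _ _ _ _ _ => rfl) (a n)
      simp only [one_mul, Nat.sub_zero, lintegral_const, measure_univ, mul_one] at this
      exact this
    · exact lintegral_mul_pathCoord_pair_le (m := m) (n := n) (hJWm m)
        (fun i j b hb r u => by
          rw [hJinv m i j b hb, hWinv m i j b hb]) (a n)
  -- Finiteness is needed before half of the sum can be absorbed into the left side below.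
  have hfin : ∑ n ∈ Finset.range N, α n ≠ ⊤ := by
    refine ENNReal.sum_ne_top.2 fun n _ => ?_
    have hle : α n ≤ ∫⁻ _, 2 ^ n ∂noiseLaw := by
      refine lintegral_mono fun r => ?_
      refine (mul_le_of_le_one_left' (hJ1 n r)).trans ?_
      calc W n r ≤ ∏ _m ∈ Finset.range n, (2 : ℝ≥0∞) := by
            refine Finset.prod_le_prod' fun m _ => ?_
            rw [← one_add_one_eq_two]
            gcongr
            exact mul_le_one' hε1 (hJ1 m r)
        _ = 2 ^ n := by simp
    refine ne_top_of_le_ne_top ?_ hle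
    simp
  have hconv : ∑ n ∈ Finset.range N, ∑ m ∈ Finset.range n, ψ (n - m) * α m
      ≤ Ψ * ∑ m ∈ Finset.range N, α m := by
    rw [Finset.sum_comm' (t' := Finset.range N) (s' := fun m => Finset.Ico (m + 1) N)
      (by intro x y; simp only [Finset.mem_range, Finset.mem_Ico]; omega), Finset.mul_sum]
    refine Finset.sum_le_sum fun m _ => ?_
    rw [← Finset.sum_mul]
    gcongr
    rw [Finset.sum_Ico_eq_sum_range]
    refine le_trans (Finset.sum_le_sum fun k _ => le_of_eq ?_)
      ((ENNReal.sum_le_tsum (f := fun k => ψ (k + 1)) _).trans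
        (ENNReal.tsum_comp_le_tsum_of_injective (Nat.succ_injective) ψ))
    · congr 1; omega
  have hA : ∑ n ∈ Finset.range N, α n ≤ Ψ + 2⁻¹ * ∑ n ∈ Finset.range N, α n := by
    calc ∑ n ∈ Finset.range N, α n
        ≤ ∑ n ∈ Finset.range N, (ψ n + ε * ∑ m ∈ Finset.range n, ψ (n - m) * α m) :=
          Finset.sum_le_sum fun n _ => hrec n
      _ ≤ Ψ + ε * (Ψ * ∑ m ∈ Finset.range N, α m) := by
          rw [Finset.sum_add_distrib, ← Finset.mul_sum]
          gcongr
          exact ENNReal.sum_le_tsum _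
      _ ≤ _ := by rw [← mul_assoc]; gcongr
  have hA2 : 2⁻¹ * ∑ n ∈ Finset.range N, α n ≤ Ψ := by
    have h2 : ∑ n ∈ Finset.range N, α n
        = 2⁻¹ * ∑ n ∈ Finset.range N, α n + 2⁻¹ * ∑ n ∈ Finset.range N, α n := by
      rw [← add_mul, ENNReal.inv_two_add_inv_two, one_mul]
    have h3 : 2⁻¹ * ∑ n ∈ Finset.range N, α n ≠ ⊤ := ENNReal.mul_ne_top (by simp) hfin
    rw [h2] at hA
    refine (ENNReal.add_le_add_iff_right h3).1 (hA.trans ?_)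
    rw [← h2]
  calc ∫⁻ r, W N r ∂noiseLaw = 1 + ε * ∑ n ∈ Finset.range N, α n := by
        simp_rw [hWsum N]
        rw [lintegral_add_left measurable_const, lintegral_const_mul _
          (Finset.measurable_fun_sum _ fun m _ => hJWm m),
          lintegral_finsetSum _ fun m _ => hJWm m]
        simp [hα]
    _ ≤ 1 + ε * (2 * Ψ) := by
        gcongr
        calc ∑ n ∈ Finset.range N, α n = 2 * (2⁻¹ * ∑ n ∈ Finset.range N, α n) := by
              rw [← mul_assoc, ENNReal.mul_inv_cancel (by simp) (by simp), one_mul]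
          _ ≤ 2 * Ψ := by gcongr
    _ = 1 + 2 * (ε * Ψ) := by ring
    _ ≤ 1 + 2 * 2⁻¹ := by gcongr
    _ = 2 := by rw [ENNReal.mul_inv_cancel (by simp) (by simp), one_add_one_eq_two]

end UnpredictablePath

-- Absolute continuity of randomly shifted product measures by second moments

section RandomShift

open scoped ENNReal NNReal
open Measure

/-- A measure `ν` such that on an algebra of sets generating the `σ`-algebra
`ν A ≤ K μ A + C / K` for all `K` is absolutely continuous. -/
lemma absolutelyContinuous_of_isSetAlgebra {α : Type*} [m : MeasurableSpace α] {μ ν : Measure α}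
    [IsFiniteMeasure μ] [IsFiniteMeasure ν] {𝒜 : Set (Set α)} (h𝒜 : IsSetAlgebra 𝒜)
    (hgen : m = MeasurableSpace.generateFrom 𝒜) {C : ℝ≥0∞} (hC : C ≠ ⊤)
    (h : ∀ A ∈ 𝒜, ∀ K : ℝ≥0, K ≠ 0 → ν A ≤ K * μ A + C / K) : ν ≪ μ := by
  refine AbsolutelyContinuous.mk fun N hN hμN => ?_
  have hdense := MeasureDense.of_generateFrom_isSetAlgebra_finite (μ + ν) h𝒜 hgen
  have h1 : ∀ K : ℝ≥0, K ≠ 0 → ν N ≤ C / K := by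
    intro K hK
    refine ENNReal.le_of_forall_pos_le_add fun ε hε _ => ?_
    -- The approximation error K μ(N ∆ A) + ν(N ∆ A) is at most (K + 1)η = ε.
    set η : ℝ := ε / (K + 1) with hη
    have hηpos : 0 < η := by positivity
    obtain ⟨A, hA, hlt⟩ := hdense.approx N hN (measure_ne_top _ _) η hηpos
    have hμ : μ (symmDiff N A) ≤ ENNReal.ofReal η :=
      (Measure.le_add_right le_rfl _).trans hlt.le
    have hμA : μ A ≤ μ (symmDiff N A) := by
      calc μ A ≤ μ (N ∪ symmDiff N A) := measure_mono fun x hx => by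
            by_cases hxN : x ∈ N
            · exact .inl hxN
            · exact .inr (.inr ⟨hx, hxN⟩)
        _ ≤ μ N + μ (symmDiff N A) := measure_union_le _ _
        _ = _ := by rw [hμN, zero_add]
    have hνN : ν N ≤ ν A + ν (symmDiff N A) := by
      refine (measure_mono fun x hx => ?_).trans (measure_union_le _ _)
      by_cases hxA : x ∈ A
      · exact .inl hxA
      · exact .inr (.inl ⟨hx, hxA⟩)
    have hν : K * μ (symmDiff N A) + ν (symmDiff N A) ≤ ε := by
      calc K * μ (symmDiff N A) + ν (symmDiff N A)
          ≤ (K + 1) * (μ (symmDiff N A) + ν (symmDiff N A)) := by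
            rw [mul_add, add_mul, add_mul, one_mul, one_mul]
            refine add_le_add le_self_add le_add_self
        _ ≤ (K + 1) * ENNReal.ofReal η := by
            gcongr
            exact hlt.le
        _ = ENNReal.ofReal ((K + 1) * η) := by
            rw [ENNReal.ofReal_mul (by positivity), ENNReal.ofReal_add (by positivity) one_pos.le]
            simp
        _ = ε := by
            rw [hη, mul_div_cancel₀ _ (by positivity : (K : ℝ) + 1 ≠ 0), ENNReal.ofReal_coe_nnreal]
    calc ν N ≤ K * μ A + C / K + ν (symmDiff N A) := hνN.trans (by gcongr; exact h A hA K hK)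
      _ ≤ K * μ (symmDiff N A) + C / K + ν (symmDiff N A) := by gcongr
      _ = C / K + (K * μ (symmDiff N A) + ν (symmDiff N A)) := by ring
      _ ≤ C / K + ε := by gcongr
  have hlim : Filter.Tendsto (fun n : ℕ => C / ((n + 1 : ℕ) : ℝ≥0)) Filter.atTop (nhds 0) := by
    have := ENNReal.Tendsto.const_div (a := C)
      (ENNReal.tendsto_nat_nhds_top.comp (Filter.tendsto_add_atTop_nat 1)) (.inr hC)
    simpa [Function.comp_def] using this
  exact le_antisymm (ge_of_tendsto' hlim fun n => h1 _ (by positivity)) zero_le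

variable {ι R T : Type*} [MeasurableSpace R] [MeasurableSpace T]
  (ν : ι → Measure T) [∀ i, IsProbabilityMeasure (ν i)] (ρ : Measure R) [IsProbabilityMeasure ρ]
  {θ : R → ι → T → T} {D : R → ι → T → ℝ≥0∞}

lemma measurable_randomShift (hθ : ∀ i, Measurable fun p : R × T => θ p.1 i p.2) :
    Measurable fun p : R × (ι → T) => fun i => θ p.1 i (p.2 i) :=
  measurable_pi_lambda _ fun i => (hθ i).comp
    (measurable_fst.prodMk ((measurable_pi_apply i).comp measurable_snd))

/-- Shifting the coordinates of a product measure by random transformations with densities gives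
an absolutely continuous law if the second moments of the averaged densities are bounded. -/
lemma randomShift_absolutelyContinuous (hθ : ∀ i, Measurable fun p : R × T => θ p.1 i p.2)
    (hD : ∀ i, Measurable fun p : R × T => D p.1 i p.2)
    (h : ∀ r i, ∀ g : T → ℝ≥0∞, Measurable g → ∫⁻ u, g (θ r i u) ∂ν i = ∫⁻ u, g u * D r i u ∂ν i)
    {C : ℝ≥0∞} (hC : C ≠ ⊤)
    (hmom : ∀ F : Finset ι,
      ∫⁻ r, ∫⁻ r', ∏ i ∈ F, ∫⁻ u, D r i u * D r' i u ∂ν i ∂ρ ∂ρ ≤ C) :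
    (ρ.prod (infinitePi ν)).map (fun p i => θ p.1 i (p.2 i)) ≪ infinitePi ν := by
  classical
  have hshift := measurable_randomShift hθ
  have : IsProbabilityMeasure ((ρ.prod (infinitePi ν)).map (fun p i => θ p.1 i (p.2 i))) :=
    isProbabilityMeasure_map hshift.aemeasurable
  refine absolutelyContinuous_of_isSetAlgebra (isSetAlgebra_measurableCylinders (α := fun _ : ι => T))
    generateFrom_measurableCylinders.symm hC fun A hA K hK => ?_
  have hAm : MeasurableSet A := MeasurableSet.of_mem_measurableCylinders hA
  obtain ⟨F, S, hS, rfl⟩ := (mem_measurableCylinders A).1 hA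
  have hDF : Measurable fun p : R × (ι → T) => ∏ i ∈ F, D p.1 i (p.2 i) :=
    Finset.measurable_fun_prod _ fun i _ => (hD i).comp
      (measurable_fst.prodMk ((measurable_pi_apply i).comp measurable_snd))
  -- On events determined by `F` the averaged law has density `M`. No density for all coordinates is
  -- at hand yet; what is uniform in `F` is the L² bound, obtained by writing M² with two
  -- independent copies of the shift.
  set M : (ι → T) → ℝ≥0∞ := fun l => ∫⁻ r, ∏ i ∈ F, D r i (l i) ∂ρ with hM
  have hMm : Measurable M := hDF.lintegral_prod_left'
  have h1 : (ρ.prod (infinitePi ν)).map (fun p i => θ p.1 i (p.2 i)) (cylinder F S)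
      = ∫⁻ l in cylinder F S, M l ∂infinitePi ν := by
    have hind : Measurable fun p : R × (ι → T) =>
        (cylinder F S).indicator (1 : (ι → T) → ℝ≥0∞) fun i => θ p.1 i (p.2 i) :=
      (measurable_one.indicator hAm).comp hshift
    rw [← lintegral_indicator_one hAm, lintegral_map (measurable_one.indicator hAm) hshift,
      lintegral_prod _ hind.aemeasurable]
    have hr : ∀ r, ∫⁻ l, (cylinder F S).indicator (1 : (ι → T) → ℝ≥0∞) (fun i => θ r i (l i))
        ∂infinitePi ν = ∫⁻ l in cylinder F S, ∏ i ∈ F, D r i (l i) ∂infinitePi ν := by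
      intro r
      have h2 := lintegral_comp_piecewise ν F (θ := θ r) (D := D r)
        (fun i => (hθ i).comp measurable_prodMk_left) (fun i => (hD i).comp measurable_prodMk_left)
        (h r) (measurable_one.indicator hAm)
      rw [← lintegral_indicator hAm]
      have h3 : ∀ l : ι → T, (cylinder F S).indicator (1 : (ι → T) → ℝ≥0∞) (fun i => θ r i (l i))
          = (cylinder F S).indicator 1 (fun i => if i ∈ F then θ r i (l i) else l i) := by
        intro l
        have : ((fun i => θ r i (l i)) ∈ cylinder F S)
            ↔ (fun i => if i ∈ F then θ r i (l i) else l i) ∈ cylinder F S := by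
          rw [mem_cylinder, mem_cylinder]
          have : F.restrict (fun i => θ r i (l i))
              = F.restrict (fun i => if i ∈ F then θ r i (l i) else l i) := by
            funext i
            simp
          rw [this]
        simp only [Set.indicator_apply, this]
        rfl
      simp_rw [h3]
      rw [h2]
      refine lintegral_congr fun l => ?_
      simp only [Set.indicator_apply, Pi.one_apply]
      split_ifs <;> simp
    simp only [hr]
    rw [lintegral_lintegral_swap hDF.aemeasurable]
  have h2 : ∫⁻ l, M l * M l ∂infinitePi ν ≤ C := by
    have hM2 : ∀ l, M l * M l
        = ∫⁻ r, ∫⁻ r', ∏ i ∈ F, (D r i (l i) * D r' i (l i)) ∂ρ ∂ρ := by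
      intro l
      have hm : Measurable fun r => ∏ i ∈ F, D r i (l i) := hDF.comp measurable_prodMk_right
      simp_rw [Finset.prod_mul_distrib, lintegral_const_mul _ hm]
      rw [lintegral_mul_const _ hm]
    have hbig : Measurable fun p : ((ι → T) × R) × R =>
        ∏ i ∈ F, (D p.1.2 i (p.1.1 i) * D p.2 i (p.1.1 i)) := by
      refine Finset.measurable_fun_prod _ fun i _ => ?_
      have hl : Measurable fun p : ((ι → T) × R) × R => p.1.1 i :=
        (measurable_pi_apply i).comp (measurable_fst.comp measurable_fst)
      exact ((hD i).comp ((measurable_snd.comp measurable_fst).prodMk hl)).mul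
        ((hD i).comp (measurable_snd.prodMk hl))
    calc ∫⁻ l, M l * M l ∂infinitePi ν
        = ∫⁻ l, ∫⁻ r, ∫⁻ r', ∏ i ∈ F, (D r i (l i) * D r' i (l i)) ∂ρ ∂ρ ∂infinitePi ν :=
          lintegral_congr hM2
      _ = ∫⁻ r, ∫⁻ l, ∫⁻ r', ∏ i ∈ F, (D r i (l i) * D r' i (l i)) ∂ρ ∂infinitePi ν ∂ρ :=
          lintegral_lintegral_swap (hbig.lintegral_prod_right').aemeasurable
      _ = ∫⁻ r, ∫⁻ r', ∫⁻ l, ∏ i ∈ F, (D r i (l i) * D r' i (l i)) ∂infinitePi ν ∂ρ ∂ρ := by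
          refine lintegral_congr fun r => lintegral_lintegral_swap ?_
          exact (hbig.comp ((measurable_fst.prodMk measurable_const).prodMk
            measurable_snd)).aemeasurable
      _ = ∫⁻ r, ∫⁻ r', ∏ i ∈ F, ∫⁻ u, D r i u * D r' i u ∂ν i ∂ρ ∂ρ := by
          refine lintegral_congr fun r => lintegral_congr fun r' => ?_
          exact lintegral_prod_coordinates ν F (f := fun i u => D r i u * D r' i u) fun i =>
            ((hD i).comp measurable_prodMk_left).mul ((hD i).comp measurable_prodMk_left)
      _ ≤ C := hmom F
  have hK0 : (K : ℝ≥0∞) ≠ 0 := by simpa using hK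
  -- Truncation at level `K` turns the L² bound into the criterion ν A ≤ K μ A + C/K.
  have hpt : ∀ l, M l ≤ K + M l * M l / K := by
    intro l
    rcases le_total (M l) K with hle | hle
    · exact hle.trans le_self_add
    · refine le_trans ?_ le_add_self
      rw [ENNReal.le_div_iff_mul_le (.inl hK0) (.inl ENNReal.coe_ne_top)]
      gcongr
  rw [h1]
  calc ∫⁻ l in cylinder F S, M l ∂infinitePi ν
      ≤ ∫⁻ l in cylinder F S, (K + M l * M l / K) ∂infinitePi ν := lintegral_mono hpt
    _ = K * infinitePi ν (cylinder F S) + ∫⁻ l in cylinder F S, M l * M l / K ∂infinitePi ν := by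
        rw [lintegral_add_left measurable_const, setLIntegral_const]
    _ ≤ K * infinitePi ν (cylinder F S) + C / K := by
        gcongr
        refine (setLIntegral_le_lintegral _ _).trans ?_
        simp_rw [div_eq_mul_inv]
        rw [lintegral_mul_const (f := fun l => M l * M l) _ (hMm.mul hMm)]
        gcongr

end RandomShift

-- Deleting a site by shifting along a random path

section PathShift

open scoped ENNReal NNReal
open Measure

variable {d : ℕ}

/-- A random path in the lattice from `x₀`, moving at unit speed in the first direction. -/
noncomputable def latticePath (x₀ : Fin d → ℤ) (r : PathNoise) (n : ℕ) : Fin d → ℤ := fun j =>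
  x₀ j + if j.val = 0 then (n : ℤ) else if j.val = 1 then pathCoord r 0 n
    else if j.val = 2 then pathCoord r 1 n else 0

/-- The time at which a path from `x₀` can visit `v`. -/
def pathLevel [NeZero d] (x₀ v : Fin d → ℤ) : ℕ := (v 0 - x₀ 0).toNat

lemma pathLevel_latticePath [NeZero d] (x₀ : Fin d → ℤ) (r : PathNoise) (n : ℕ) :
    pathLevel x₀ (latticePath x₀ r n) = n := by
  simp [pathLevel, latticePath]

lemma pathLevel_self [NeZero d] (x₀ : Fin d → ℤ) : pathLevel x₀ x₀ = 0 := by simp [pathLevel]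

lemma latticePath_zero (x₀ : Fin d → ℤ) (r : PathNoise) : latticePath x₀ r 0 = x₀ := by
  funext j
  simp [latticePath, pathCoord_zero]

lemma measurable_latticePath (x₀ : Fin d → ℤ) (n : ℕ) :
    Measurable fun r => latticePath x₀ r n := by
  refine measurable_pi_lambda _ fun j => ?_
  unfold latticePath
  have h0 := measurable_pathCoord 0 n
  have h1 := measurable_pathCoord 1 n
  split_ifs <;> fun_prop

lemma abs_latticePath_succ_sub_le (x₀ : Fin d → ℤ) (r : PathNoise) (n : ℕ) (j : Fin d) :
    |latticePath x₀ r (n + 1) j - latticePath x₀ r n j| ≤ 2 := by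
  simp only [latticePath, add_sub_add_left_eq_sub]
  split_ifs
  · simp
  · exact abs_pathCoord_succ_sub_le r 0 n
  · exact abs_pathCoord_succ_sub_le r 1 n
  · simp

/-- Beyond d > 0, the dimension matters only here: besides the time direction there must be room for
two unpredictable coordinates. -/
lemma pathCoord_eq_of_latticePath_eq (hd : 3 ≤ d) {x₀ : Fin d → ℤ} {r r' : PathNoise} {n : ℕ}
    (h : latticePath x₀ r n = latticePath x₀ r' n) (i : Fin 2) :
    pathCoord r i n = pathCoord r' i n := by
  have h1 := congrFun h ⟨1, by omega⟩
  have h2 := congrFun h ⟨2, by omega⟩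
  simp only [latticePath] at h1 h2
  revert i
  rw [Fin.forall_fin_two]
  exact ⟨by simpa using h1, by simpa using h2⟩

open Classical in
/-- The successor of a site along the path; sites off the path are fixed. -/
noncomputable def pathNext [NeZero d] (x₀ : Fin d → ℤ) (r : PathNoise) (v : Fin d → ℤ) :
    Fin d → ℤ :=
  if latticePath x₀ r (pathLevel x₀ v) = v then latticePath x₀ r (pathLevel x₀ v + 1) else v

open Classical in
/-- The predecessor of a site along the path; sites off the path are fixed. -/
noncomputable def pathPrev [NeZero d] (x₀ : Fin d → ℤ) (r : PathNoise) (v : Fin d → ℤ) :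
    Fin d → ℤ :=
  -- Truncated subtraction sends `x₀` to itself, so the map is injective only away from `x₀`; the
  -- value there is irrelevant since that site is deleted.
  if latticePath x₀ r (pathLevel x₀ v) = v then latticePath x₀ r (pathLevel x₀ v - 1) else v

variable [NeZero d]

lemma pathPrev_pathNext (x₀ : Fin d → ℤ) (r : PathNoise) (v : Fin d → ℤ) :
    pathPrev x₀ r (pathNext x₀ r v) = v := by
  unfold pathNext
  split_ifs with h
  · rw [pathPrev, pathLevel_latticePath, if_pos rfl, Nat.add_sub_cancel, h]
  · rw [pathPrev, if_neg h]

lemma pathNext_ne (x₀ : Fin d → ℤ) (r : PathNoise) (v : Fin d → ℤ) : pathNext x₀ r v ≠ x₀ := by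
  intro heq
  unfold pathNext at heq
  split_ifs at heq with h
  · have := congrArg (pathLevel x₀) heq
    rw [pathLevel_latticePath, pathLevel_self] at this
    omega
  · refine h ?_
    rw [heq, pathLevel_self, latticePath_zero]

lemma pathNext_pathPrev (x₀ : Fin d → ℤ) (r : PathNoise) {w : Fin d → ℤ} (hw : w ≠ x₀) :
    pathNext x₀ r (pathPrev x₀ r w) = w := by
  unfold pathPrev
  split_ifs with h
  · have hpos : pathLevel x₀ w ≠ 0 := fun h0 => hw (by rw [← h, h0, latticePath_zero])
    rw [pathNext, pathLevel_latticePath, if_pos rfl, Nat.sub_add_cancel (by omega), h]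
  · rw [pathNext, if_neg h]

lemma measurable_pathNext (x₀ v : Fin d → ℤ) : Measurable fun r => pathNext x₀ r v := by
  classical
  unfold pathNext
  exact Measurable.ite (measurable_latticePath x₀ _ (measurableSet_singleton v))
    (measurable_latticePath x₀ _) measurable_const

/-- The displacement that moves `v` to its successor. -/
noncomputable def pathShift (x₀ : Fin d → ℤ) (r : PathNoise) (v : Fin d → ℤ) :
    EuclideanSpace ℝ (Fin d) :=
  latticePoint (pathNext x₀ r v) - latticePoint v

lemma measurable_pathShift (x₀ v : Fin d → ℤ) : Measurable fun r => pathShift x₀ r v := by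
  unfold pathShift
  exact ((measurable_of_countable latticePoint).comp (measurable_pathNext x₀ v)).sub_const _

lemma pathShift_eq_zero {x₀ v : Fin d → ℤ} {r : PathNoise}
    (h : latticePath x₀ r (pathLevel x₀ v) ≠ v) : pathShift x₀ r v = 0 := by
  rw [pathShift, pathNext, if_neg h, sub_self]

lemma abs_pathShift_le (x₀ v : Fin d → ℤ) (r : PathNoise) (j : Fin d) :
    |pathShift x₀ r v j| ≤ 2 := by
  by_cases h : latticePath x₀ r (pathLevel x₀ v) = v
  · have := abs_latticePath_succ_sub_le x₀ r (pathLevel x₀ v) j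
    rw [h] at this
    rw [pathShift, pathNext, if_pos h]
    simp only [latticePoint, PiLp.sub_apply]
    exact_mod_cast this
  · simp [pathShift_eq_zero h]

/-- The second moment of the densities is controlled by the number of meetings of two paths. -/
lemma prod_exp_pathShift_le (hd : 3 ≤ d) {t : ℝ} {ε : ℝ≥0∞}
    (hε : ENNReal.ofReal (Real.exp (4 * d / t ^ 2)) ≤ 1 + ε) (x₀ : Fin d → ℤ)
    (F : Finset (Fin d → ℤ)) : ∃ N : ℕ, ∀ r r' : PathNoise,
    ∏ v ∈ F, ENNReal.ofReal (Real.exp ((∑ j, pathShift x₀ r v j * pathShift x₀ r' v j) / t ^ 2))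
      ≤ ∏ n ∈ Finset.range N,
        (1 + ε * if ∀ i, pathCoord r i n = pathCoord r' i n then 1 else 0) := by
  classical
  refine ⟨F.sup (pathLevel x₀) + 1, fun r r' => ?_⟩
  -- Only sites common to both paths matter, since elsewhere one shift vanishes and the factor is 1.
  -- A path visits each level once, so the product over these sites is a product over meeting times.
  let G := F.filter fun v => latticePath x₀ r (pathLevel x₀ v) = v ∧
    latticePath x₀ r' (pathLevel x₀ v) = v
  have hinj : Set.InjOn (pathLevel x₀) (G : Set (Fin d → ℤ)) := by
    intro v hv w hw hvw
    have h1 := (Finset.mem_filter.1 hv).2.1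
    have h2 := (Finset.mem_filter.1 hw).2.1
    rw [← h1, ← h2, hvw]
  calc ∏ v ∈ F, ENNReal.ofReal
        (Real.exp ((∑ j, pathShift x₀ r v j * pathShift x₀ r' v j) / t ^ 2))
      = ∏ v ∈ G, ENNReal.ofReal
        (Real.exp ((∑ j, pathShift x₀ r v j * pathShift x₀ r' v j) / t ^ 2)) := by
        refine (Finset.prod_subset (Finset.filter_subset _ _) fun v hv hvG => ?_).symm
        have : ¬ (latticePath x₀ r (pathLevel x₀ v) = v ∧
          latticePath x₀ r' (pathLevel x₀ v) = v) := fun h => hvG (Finset.mem_filter.2 ⟨hv, h⟩)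
        rw [not_and_or] at this
        rcases this with h | h <;> simp [pathShift_eq_zero h]
    _ ≤ ∏ v ∈ G, (1 + ε * if ∀ i, pathCoord r i (pathLevel x₀ v)
          = pathCoord r' i (pathLevel x₀ v) then 1 else 0) := by
        refine Finset.prod_le_prod' fun v hv => ?_
        have h := (Finset.mem_filter.1 hv).2
        rw [if_pos fun i => pathCoord_eq_of_latticePath_eq hd (h.1.trans h.2.symm) i, mul_one]
        refine le_trans (ENNReal.ofReal_le_ofReal ?_) hε
        gcongr
        calc ∑ j, pathShift x₀ r v j * pathShift x₀ r' v j ≤ ∑ _j : Fin d, (4 : ℝ) := by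
              refine Finset.sum_le_sum fun j _ => ?_
              have h1 := abs_pathShift_le x₀ v r j
              have h2 := abs_pathShift_le x₀ v r' j
              calc pathShift x₀ r v j * pathShift x₀ r' v j
                  ≤ |pathShift x₀ r v j| * |pathShift x₀ r' v j| := by
                    rw [← abs_mul]; exact le_abs_self _
                _ ≤ 2 * 2 := by gcongr
                _ = 4 := by norm_num
          _ = 4 * d := by simp [mul_comm]
    _ = ∏ n ∈ G.image (pathLevel x₀), (1 + ε * if ∀ i, pathCoord r i n = pathCoord r' i n
          then 1 else 0) := (Finset.prod_image (f := fun n => 1 + ε *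
            if ∀ i, pathCoord r i n = pathCoord r' i n then 1 else 0) hinj).symm
    _ ≤ _ := by
        refine Finset.prod_le_prod_of_subset_of_one_le' (fun n hn => ?_) fun n _ _ => le_self_add
        obtain ⟨v, hv, rfl⟩ := Finset.mem_image.1 hn
        rw [Finset.mem_range, Nat.lt_succ_iff]
        exact Finset.le_sup (f := pathLevel x₀) (Finset.mem_filter.1 hv).1

/-- A meeting costs at most a factor exp(4d/t²), as the shifts have coordinates bounded by 2. For
large `t` this is as close to 1 as the meeting estimate requires. -/
lemma exists_variance_bound (d : ℕ) : ∃ t : ℝ, 0 < t ∧ ∃ ε : ℝ≥0∞,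
    ε * ∑' k, predictability k ^ 2 ≤ 2⁻¹ ∧ ε ≤ 1 ∧
      ENNReal.ofReal (Real.exp (4 * d / t ^ 2)) ≤ 1 + ε := by
  set P : ℝ := (∑' k, predictability k ^ 2).toReal with hP
  have hP0 : 0 ≤ P := ENNReal.toReal_nonneg
  set η : ℝ := 1 / (2 * (P + 1)) with hη
  have hηpos : 0 < η := by positivity
  have hlog : 0 < Real.log (1 + η) := Real.log_pos (by linarith)
  have ht2 : 0 < (4 * d + 1) / Real.log (1 + η) := by positivity
  refine ⟨√((4 * d + 1) / Real.log (1 + η)), Real.sqrt_pos.2 ht2, ENNReal.ofReal η, ?_, ?_, ?_⟩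
  · rw [← ENNReal.ofReal_toReal tsum_predictability_sq_ne_top, ← hP,
      ← ENNReal.ofReal_mul hηpos.le, ← ENNReal.ofReal_ofNat 2,
      ← ENNReal.ofReal_inv_of_pos two_pos]
    apply ENNReal.ofReal_le_ofReal
    rw [hη, one_div_mul_eq_div, div_le_iff₀ (by positivity)]
    linarith
  · rw [← ENNReal.ofReal_one]
    apply ENNReal.ofReal_le_ofReal
    rw [hη, div_le_one (by positivity)]
    linarith
  · rw [← ENNReal.ofReal_one, ← ENNReal.ofReal_add one_pos.le hηpos.le]
    apply ENNReal.ofReal_le_ofReal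
    rw [← Real.le_log_iff_exp_le (by linarith), Real.sq_sqrt ht2.le, div_le_iff₀ ht2,
      mul_div_cancel₀ _ hlog.ne']
    linarith

/-- The points of the field with label outside the site `x₀`. -/
def pointsOff (x₀ : Fin d → ℤ) (l : (Fin d → ℤ) → SiteData d) : Set (EuclideanSpace ℝ (Fin d)) :=
  {z | ∃ q : (Fin d → ℤ) × Fin 2, q.1 ≠ x₀ ∧ fieldPoint l q = z}

/-- Moving every site of the path to its successor amounts to deleting the starting point. -/
lemma range_fieldPoint_pathShift (x₀ : Fin d → ℤ) (r : PathNoise)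
    (l : (Fin d → ℤ) → SiteData d) :
    Set.range (fieldPoint fun v => ((l v).1 + pathShift x₀ r v, (l v).2))
      = pointsOff x₀ fun w => l (pathPrev x₀ r w) := by
  have key : ∀ v i, fieldPoint (fun v => ((l v).1 + pathShift x₀ r v, (l v).2)) (v, i)
      = fieldPoint (fun w => l (pathPrev x₀ r w)) (pathNext x₀ r v, i) := by
    intro v i
    simp only [fieldPoint, pathPrev_pathNext, pathShift]
    abel
  ext z
  constructor
  · rintro ⟨⟨v, i⟩, rfl⟩
    exact ⟨(pathNext x₀ r v, i), pathNext_ne x₀ r v, (key v i).symm⟩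
  · rintro ⟨⟨w, i⟩, hw, rfl⟩
    refine ⟨(pathPrev x₀ r w, i), ?_⟩
    rw [key, pathNext_pathPrev x₀ r hw]

omit [NeZero d] in
lemma measurable_range_fieldPoint : Measurable (β := PointConfig (EuclideanSpace ℝ (Fin d)))
    fun l : (Fin d → ℤ) → SiteData d => Set.range (fieldPoint l) := by
  have := measurable_config_of_countable (measurable_fieldPoint (d := d)) (C := fun _ => Set.univ)
    fun _ => MeasurableSet.univ
  simpa [Set.range] using this

omit [NeZero d] in
/-- Two fields whose restrictions off `x₀` come from injective relabellings give the same law. -/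
lemma fieldLaw_pointsOff_comp {t δ : ℝ} (x₀ : Fin d → ℤ) {f : (Fin d → ℤ) → (Fin d → ℤ)}
    (hf : Set.InjOn f {x₀}ᶜ) {N : Set (PointConfig (EuclideanSpace ℝ (Fin d)))}
    (hN : MeasurableSet N) :
    fieldLaw d t δ {l | asConfig (pointsOff x₀ fun w => l (f w)) ∈ N}
      = fieldLaw d t δ {l | asConfig (pointsOff x₀ l) ∈ N} := by
  let Φ : (({x₀}ᶜ : Set (Fin d → ℤ)) → SiteData d) → Set (EuclideanSpace ℝ (Fin d)) :=
    fun m => {z | ∃ q : ({x₀}ᶜ : Set (Fin d → ℤ)) × Fin 2, m ∈ Set.univ ∧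
      latticePoint (q.1 : Fin d → ℤ) + ((m q.1).1 + (m q.1).2 q.2) = z}
  have hΦ : Measurable (β := PointConfig (EuclideanSpace ℝ (Fin d))) Φ :=
    measurable_config_of_countable (fun q => by fun_prop)
    (C := fun _ => Set.univ) fun _ => MeasurableSet.univ
  have hΦeq : ∀ g : (Fin d → ℤ) → SiteData d, Φ (fun w => g w) = pointsOff x₀ g := by
    intro g
    ext z
    constructor
    · rintro ⟨⟨⟨w, hw⟩, i⟩, _, rfl⟩
      exact ⟨(w, i), hw, rfl⟩
    · rintro ⟨⟨w, i⟩, hw, rfl⟩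
      exact ⟨(⟨w, hw⟩, i), trivial, rfl⟩
  have hlaw : ∀ g : (Fin d → ℤ) → (Fin d → ℤ), Set.InjOn g {x₀}ᶜ →
      fieldLaw d t δ {l | asConfig (pointsOff x₀ fun w => l (g w)) ∈ N}
        = infinitePi (fun _ : ({x₀}ᶜ : Set (Fin d → ℤ)) => siteLaw d t δ)
          {m | asConfig (Φ m) ∈ N} := by
    intro g hg
    have hset : MeasurableSet {m | asConfig (Φ m) ∈ N} := hΦ hN
    rw [← map_infinitePi_infinitePi_of_inj (P := fun _ : Fin d → ℤ => siteLaw d t δ)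
      (f := fun w : ({x₀}ᶜ : Set (Fin d → ℤ)) => g w) hg.injective,
      map_apply (by fun_prop) hset]
    refine congrArg _ (Set.ext fun l => ?_)
    simp only [Set.mem_preimage, Set.mem_ofPred_eq]
    rw [hΦeq fun w => l (g w)]
  rw [hlaw f hf, ← hlaw id (Set.injOn_id _)]
  rfl

/-- For large variance of the common displacements, the law of the configuration without the pair
of one site is absolutely continuous with respect to the law of the whole configuration. -/
lemma pointsOff_null (hd : 3 ≤ d) {t δ : ℝ} (ht : 0 < t) {ε : ℝ≥0∞}
    (hε : ε * ∑' k, predictability k ^ 2 ≤ 2⁻¹) (hε1 : ε ≤ 1)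
    (hεt : ENNReal.ofReal (Real.exp (4 * d / t ^ 2)) ≤ 1 + ε) (x₀ : Fin d → ℤ)
    {N : Set (PointConfig (EuclideanSpace ℝ (Fin d)))} (hN : MeasurableSet N)
    (h0 : fieldLaw d t δ {l | asConfig (Set.range (fieldPoint l)) ∈ N} = 0) :
    fieldLaw d t δ {l | asConfig (pointsOff x₀ l) ∈ N} = 0 := by
  have hDs : ∀ s s' : EuclideanSpace ℝ (Fin d),
      ∫⁻ u, isoShiftDensity t s u.1 * isoShiftDensity t s' u.1 ∂siteLaw d t δ
        = ENNReal.ofReal (Real.exp ((∑ j, s j * s' j) / t ^ 2)) := by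
    intro s s'
    have hm : Measurable fun y => isoShiftDensity t s y * isoShiftDensity t s' y :=
      (measurable_isoShiftDensity s).mul (measurable_isoShiftDensity s')
    rw [← lintegral_isoShiftDensity_mul ht, siteLaw,
      lintegral_prod (fun u : SiteData d => isoShiftDensity t s u.1 * isoShiftDensity t s' u.1)
        (hm.comp measurable_fst).aemeasurable]
    simp
  have hac := randomShift_absolutelyContinuous (fun _ : Fin d → ℤ => siteLaw d t δ) noiseLaw
    (θ := fun r v u => (u.1 + pathShift x₀ r v, u.2))
    (D := fun r v u => isoShiftDensity t (pathShift x₀ r v) u.1) (C := 2)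
    (fun v => by
      have := measurable_pathShift x₀ v
      fun_prop)
    (fun v => by
      unfold isoShiftDensity shiftDensity
      have := measurable_pathShift x₀ v
      fun_prop)
    (fun r v g hg => by
      have h1 : Measurable fun u : SiteData d => g (u.1 + pathShift x₀ r v, u.2) := by fun_prop
      have h2 : Measurable fun u : SiteData d => g u * isoShiftDensity t (pathShift x₀ r v) u.1 :=
        hg.mul ((measurable_isoShiftDensity _).comp measurable_fst)
      rw [siteLaw, lintegral_prod_symm _ h1.aemeasurable, lintegral_prod_symm _ h2.aemeasurable]
      exact lintegral_congr fun f => lintegral_isoGaussian_add ht _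
        (hg.comp measurable_prodMk_right))
    (by simp)
    (fun F => by
      obtain ⟨M, hM⟩ := prod_exp_pathShift_le hd hεt x₀ F
      simp_rw [hDs]
      suffices h : ∀ r, ∫⁻ r', ∏ v ∈ F, ENNReal.ofReal (Real.exp
          ((∑ j, pathShift x₀ r v j * pathShift x₀ r' v j) / t ^ 2)) ∂noiseLaw ≤ 2 from
        (lintegral_mono h).trans (by simp)
      -- The meeting bound is uniform over fixed opponents, so one path is frozen and only the other
      -- is averaged.
      intro r
      calc _ ≤ ∫⁻ r', ∏ n ∈ Finset.range M, (1 + ε *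
            if ∀ i, pathCoord r' i n = pathCoord r i n then 1 else 0) ∂noiseLaw := by
            refine lintegral_mono fun r' => ?_
            simp_rw [mul_comm (pathShift x₀ r _ _)]
            exact hM r' r
        _ ≤ 2 := lintegral_prod_meeting_le hε hε1 (fun n i => pathCoord r i n) M)
  have hset : MeasurableSet {l : (Fin d → ℤ) → SiteData d |
      asConfig (Set.range (fieldPoint l)) ∈ N} := measurable_range_fieldPoint hN
  have h1 := hac h0
  have hshift : Measurable fun p : PathNoise × ((Fin d → ℤ) → SiteData d) =>
      fun v => ((p.2 v).1 + pathShift x₀ p.1 v, (p.2 v).2) := by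
    refine measurable_pi_lambda _ fun v => ?_
    have := measurable_pathShift x₀ v
    fun_prop
  rw [map_apply hshift hset] at h1
  -- A single typical path `r` is enough: off `x₀` the relabelled field has the same law whatever
  -- the path.
  have h2 := ae_ae_of_ae_prod (measure_eq_zero_iff_ae_notMem.1 h1)
  obtain ⟨r, hr⟩ := h2.exists
  rw [← fieldLaw_pointsOff_comp x₀ (f := pathPrev x₀ r)
    (Set.LeftInvOn.injOn (f₁' := pathNext x₀ r) fun w hw => pathNext_pathPrev x₀ r hw) hN]
  rw [measure_eq_zero_iff_ae_notMem]
  filter_upwards [hr] with l hl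
  intro hmem
  refine hl ?_
  simp only [Set.mem_preimage, Set.mem_ofPred_eq] at hmem ⊢
  rw [range_fieldPoint_pathShift]
  exact hmem

end PathShift

-- Local finiteness, injectivity and deletion of two labelled points

section FieldProperties

open Measure
open scoped ENNReal NNReal

variable {d : ℕ} {t δ : ℝ}

lemma l1dist_zero_le (z : EuclideanSpace ℝ (Fin d)) : l1dist 0 z ≤ d * ‖z‖ := by
  calc l1dist 0 z ≤ ∑ _j : Fin d, ‖z‖ := Finset.sum_le_sum fun j _ => by
        simpa using PiLp.norm_apply_le z j
    _ = d * ‖z‖ := by simp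

/-- Almost surely only finitely many labels have their point in a given ball. -/
lemma ae_finite_fieldPoint_mem_ball (ht : 0 < t) (hδ : 0 < δ) :
    ∀ᵐ l ∂fieldLaw d t δ, ∀ (c : EuclideanSpace ℝ (Fin d)) (r : ℝ),
      {q | fieldPoint l q ∈ Metric.ball c r}.Finite := by
  obtain ⟨K, hK⟩ := exists_tsum_stepWeight_le d ht
  set w : ((Fin d → ℤ) → SiteData d) → (Fin d → ℤ) × Fin 2 → ℝ≥0∞ :=
    fun l q => ENNReal.ofReal (Real.exp (-l1dist 0 (fieldPoint l q))) with hw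
  have hwm : ∀ q, Measurable fun l => w l q := fun q => by
    have := measurable_l1dist (measurable_const (a := (0 : EuclideanSpace ℝ (Fin d))))
      (measurable_fieldPoint q)
    fun_prop
  have hsum : ∫⁻ l, ∑' q, w l q ∂fieldLaw d t δ ≠ ∞ := by
    rw [lintegral_tsum fun q => (hwm q).aemeasurable]
    refine ne_top_of_le_ne_top ?_ ((ENNReal.tsum_le_tsum fun q => ?_).trans (hK δ hδ 1 one_pos 0))
    · finiteness
    · have hm : Measurable fun s : SiteData d => ENNReal.ofReal
          (Real.exp (-l1dist 0 (latticePoint q.1 + (s.1 + s.2 q.2)))) := by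
        have := measurable_l1dist (d := d) (f := fun _ : SiteData d => 0)
          (g := fun s : SiteData d => latticePoint q.1 + (s.1 + s.2 q.2))
          measurable_const (by fun_prop)
        fun_prop
      have := (measurePreserving_eval_infinitePi
        (fun _ : Fin d → ℤ => siteLaw d t δ) q.1).lintegral_comp hm
      simp only [Function.eval] at this
      rw [fieldLaw]
      simp only [hw, fieldPoint]
      rw [this]
      refine lintegral_mono fun s => ENNReal.ofReal_le_ofReal (Real.exp_le_exp.2 ?_)
      have := l1dist_nonneg (latticePoint q.1 + (s.1 + s.2 q.2))
        (latticePoint q.1 + (s.1 + s.2 q.2.rev))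
      linarith
  filter_upwards [ae_lt_top (Measurable.tsum hwm) hsum] with l hl c r
  -- Points of the ball have weight at least exp(-d(‖c‖ + r)), and a convergent sum has only
  -- finitely many such terms.
  refine (ENNReal.finite_const_le_of_tsum_ne_top hl.ne
    (ε := ENNReal.ofReal (Real.exp (-(d * (‖c‖ + r))))) ?_).subset fun q hq => ?_
  · simpa using Real.exp_pos _
  · refine ENNReal.ofReal_le_ofReal (Real.exp_le_exp.2 (neg_le_neg ?_))
    refine (l1dist_zero_le _).trans ?_
    gcongr
    exact (norm_lt_of_mem_ball hq).le

/-- Given all data except the individual displacement of `a`, the point of `a` has an atomless law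
and the point of `b` is fixed. -/
lemma ae_fieldPoint_injective (hd : 0 < d) (hδ : 0 < δ) :
    ∀ᵐ l ∂fieldLaw d t δ, Function.Injective (fieldPoint l) := by
  have key : ∀ a b : (Fin d → ℤ) × Fin 2, a ≠ b →
      ∀ᵐ l ∂fieldLaw d t δ, fieldPoint l a ≠ fieldPoint l b := by
    intro a b hab
    have hm : MeasurableSet {l : (Fin d → ℤ) → SiteData d | fieldPoint l a ≠ fieldPoint l b} :=
      (measurableSet_eq_fun (measurable_fieldPoint a) (measurable_fieldPoint b)).compl
    refine ae_of_ae_update _ a.1 hm (.of_forall fun l => ?_)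
    have hm' : MeasurableSet {u : SiteData d | fieldPoint (Function.update l a.1 u) a
        ≠ fieldPoint (Function.update l a.1 u) b} := measurable_update l hm
    refine (ae_prod_iff_ae_ae hm').2 (.of_forall fun y => ?_)
    refine ae_of_ae_update _ a.2 (measurable_prodMk_left hm') (.of_forall fun f => ?_)
    have hb : ∀ u, fieldPoint (Function.update l a.1 (y, Function.update f a.2 u)) b
        = fieldPoint (Function.update l a.1 (y, f)) b := by
      intro u
      by_cases h : b.1 = a.1
      · have h2 : b.2 ≠ a.2 := fun h2 => hab (Prod.ext h h2).symm
        simp [fieldPoint, h, h2]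
      · rw [fieldPoint_update_of_ne h, fieldPoint_update_of_ne h]
    have hz := isoGaussian_singleton hd hδ
      (fieldPoint (Function.update l a.1 (y, f)) b - latticePoint a.1 - y)
    rw [measure_eq_zero_iff_ae_notMem] at hz
    filter_upwards [hz] with u hu heq
    rw [hb] at heq
    refine hu ?_
    rw [Set.mem_singleton_iff, ← heq]
    simp [fieldPoint]
  have := ae_all_iff.2 fun a => ae_all_iff.2 fun b => ae_all_iff.2 fun h : a ≠ b => key a b h
  filter_upwards [this] with l hl a b
  exact not_imp_not.1 (hl a b)

lemma isClosed_of_finite_inter_ball {E : Type*} [MetricSpace E] {s : Set E}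
    (h : ∀ (c : E) (r : ℝ), (s ∩ Metric.ball c r).Finite) : IsClosed s := by
  refine isClosed_of_closure_subset fun x hx => ?_
  have h1 := Metric.isOpen_ball.inter_closure ⟨Metric.mem_ball_self one_pos, hx⟩
  rw [Set.inter_comm, (h x 1).isClosed.closure_eq] at h1
  exact h1.1

/-- Replacing one individual displacement of a site by an independent random vector with a density,
up to a shift depending on the other data, preserves almost sure events. -/
lemma ae_siteLaw_replace (hδ : 0 < δ) {p : SiteData d → Prop} (hm : MeasurableSet {s | p s})
    (hp : ∀ᵐ s ∂siteLaw d t δ, p s) (i j : Fin 2) (v : EuclideanSpace ℝ (Fin d)) :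
    ∀ᵐ s ∂siteLaw d t δ, ∀ᵐ s' ∂siteLaw d t δ,
      p (s'.1, Function.update s'.2 j (v + (s.1 + s.2 i) - s'.1)) := by
  have hK : Measurable fun w : SiteData d × SiteData d =>
      ((w.2.1, Function.update w.2.2 j (v + (w.1.1 + w.1.2 i) - w.2.1)) : SiteData d) := by
    refine Measurable.prodMk (by fun_prop) ?_
    exact (measurable_update_pair (X := fun _ : Fin 2 => EuclideanSpace ℝ (Fin d)) j).comp
      (g := fun p : (Fin 2 → EuclideanSpace ℝ (Fin d)) × EuclideanSpace ℝ (Fin d) =>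
        Function.update p.1 j p.2)
      (f := fun w : SiteData d × SiteData d => (w.2.2, v + (w.1.1 + w.1.2 i) - w.2.1))
      (by fun_prop)
  refine (ae_ae_comm (p := fun s s' : SiteData d =>
    p (s'.1, Function.update s'.2 j (v + (s.1 + s.2 i) - s'.1))) (hK hm)).2 ?_
  have hresample := ((MeasurePreserving.id (isoGaussian d t)).prod
    (measurePreserving_update (fun _ : Fin 2 => isoGaussian d δ) j)).comp
    (measurePreserving_prodAssoc (isoGaussian d t)
      (infinitePi fun _ : Fin 2 => isoGaussian d δ) (isoGaussian d δ))
  have h1 := ae_ae_of_ae_prod (hresample.quasiMeasurePreserving.ae hp)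
  filter_upwards [h1] with s' hs'
  refine (ae_prod_iff_ae_ae ((hK.comp measurable_prodMk_right) hm)).2 (.of_forall fun y => ?_)
  -- With `s'` and the common displacement `y` fixed, the substitute is the Gaussian `f i` plus a
  -- constant, and its null sets are those of the displacement it replaces.
  have h2 := ae_isoGaussian_add hδ hs' (v + y - s'.1)
  filter_upwards [(measurePreserving_eval_infinitePi
    (fun _ : Fin 2 => isoGaussian d δ) i).quasiMeasurePreserving.ae h2] with f hf
  convert hf using 3
  simp only [Function.comp, MeasurableEquiv.prodAssoc, MeasurableEquiv.coe_mk,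
    Equiv.prodAssoc_apply, Prod.map, id, Function.eval]
  congr 2
  abel

lemma pointsOff_congr {x : Fin d → ℤ} {l l' : (Fin d → ℤ) → SiteData d}
    (h : ∀ w, w ≠ x → l w = l' w) : pointsOff x l = pointsOff x l' := by
  ext z
  simp only [pointsOff, Set.mem_ofPred_eq]
  refine exists_congr fun q => and_congr_right fun hq => ?_
  simp [fieldPoint, h _ hq]

lemma measurable_pointsOff (x : Fin d → ℤ) : Measurable (β := PointConfig (EuclideanSpace ℝ (Fin d)))
    fun l : (Fin d → ℤ) → SiteData d => pointsOff x l := by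
  have := measurable_config_of_countable (measurable_fieldPoint (d := d))
    (C := fun q => {_l | q.1 ≠ x}) fun _ => MeasurableSet.const _
  simpa [pointsOff] using this

/-- Moving the point of `a` onto the partner of `b`, at another site, turns the field without the
site of `b` into the whole field without `a` and `b`. -/
lemma range_fieldPoint_diff_pair {l : (Fin d → ℤ) → SiteData d}
    (hl : Function.Injective (fieldPoint l)) {a b : (Fin d → ℤ) × Fin 2} (hab : a.1 ≠ b.1) :
    Set.range (fieldPoint l) \ {fieldPoint l a, fieldPoint l b}
      = pointsOff a.1 (Function.update l b.1 ((l b.1).1, Function.update (l b.1).2 b.2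
        (latticePoint a.1 - latticePoint b.1 + ((l a.1).1 + (l a.1).2 a.2.rev) - (l b.1).1))) := by
  set l' := Function.update l b.1 ((l b.1).1, Function.update (l b.1).2 b.2
        (latticePoint a.1 - latticePoint b.1 + ((l a.1).1 + (l a.1).2 a.2.rev) - (l b.1).1)) with hl'
  have hb : fieldPoint l' b = fieldPoint l (partner a) := by
    simp only [fieldPoint, hl', Function.update_self, partner]
    abel
  have hne : ∀ q, q ≠ b → fieldPoint l' q = fieldPoint l q := by
    intro q hq
    by_cases h1 : q.1 = b.1
    · have h2 : q.2 ≠ b.2 := fun h2 => hq (Prod.ext h1 h2)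
      simp [fieldPoint, hl', h1, h2]
    · exact fieldPoint_update_of_ne h1
  ext z
  simp only [pointsOff, Set.mem_sdiff, Set.mem_range, Set.mem_insert_iff, Set.mem_singleton_iff,
    not_or, Set.mem_ofPred_eq]
  constructor
  · rintro ⟨⟨q, rfl⟩, h1, h2⟩
    have hqa : q ≠ a := fun h => h1 (h ▸ rfl)
    have hqb : q ≠ b := fun h => h2 (h ▸ rfl)
    by_cases hq : q.1 = a.1
    · rcases eq_or_eq_partner hq with h | h
      · exact absurd h hqa
      · exact ⟨b, hab.symm, h ▸ hb⟩
    · exact ⟨q, hq, hne q hqb⟩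
  · rintro ⟨q, hq, rfl⟩
    by_cases hqb : q = b
    · subst hqb
      rw [hb]
      refine ⟨⟨_, rfl⟩, fun h => partner_ne a (hl h), fun h => ?_⟩
      have := congrArg Prod.fst (hl h)
      exact hab this
    · rw [hne q hqb]
      exact ⟨⟨_, rfl⟩, fun h => hq (congrArg Prod.fst (hl h)), fun h => hqb (hl h)⟩

lemma range_fieldPoint_diff_partner {l : (Fin d → ℤ) → SiteData d}
    (hl : Function.Injective (fieldPoint l)) (a : (Fin d → ℤ) × Fin 2) :
    Set.range (fieldPoint l) \ {fieldPoint l a, fieldPoint l (partner a)} = pointsOff a.1 l := by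
  ext z
  simp only [pointsOff, Set.mem_sdiff, Set.mem_range, Set.mem_insert_iff, Set.mem_singleton_iff,
    not_or, Set.mem_ofPred_eq]
  constructor
  · rintro ⟨⟨q, rfl⟩, h1, h2⟩
    refine ⟨q, fun hq => ?_, rfl⟩
    rcases eq_or_eq_partner hq with h | h
    · exact h1 (h ▸ rfl)
    · exact h2 (h ▸ rfl)
  · rintro ⟨q, hq, rfl⟩
    refine ⟨⟨q, rfl⟩, fun h => hq (congrArg Prod.fst (hl h)), fun h => ?_⟩
    have := congrArg Prod.fst (hl h)
    exact hq this

/-- If the field without an arbitrary site almost surely avoids `N`, so does the field without two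
arbitrary points. -/
lemma ae_range_fieldPoint_diff_notMem (hd : 0 < d) (hδ : 0 < δ)
    {N : Set (PointConfig (EuclideanSpace ℝ (Fin d)))} (hN : MeasurableSet N)
    (h0 : ∀ x, fieldLaw d t δ {l | asConfig (pointsOff x l) ∈ N} = 0)
    {a b : (Fin d → ℤ) × Fin 2} (hab : a ≠ b) :
    ∀ᵐ l ∂fieldLaw d t δ,
      asConfig (Set.range (fieldPoint l) \ {fieldPoint l a, fieldPoint l b}) ∉ N := by
  have hoff : ∀ᵐ l ∂fieldLaw d t δ, asConfig (pointsOff a.1 l) ∉ N :=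
    measure_eq_zero_iff_ae_notMem.1 (h0 a.1)
  by_cases hs : b.1 = a.1
  · obtain rfl : b = partner a := (eq_or_eq_partner hs).resolve_left (Ne.symm hab)
    filter_upwards [hoff, ae_fieldPoint_injective hd hδ] with l h1 h2
    rwa [range_fieldPoint_diff_partner h2]
  set K : SiteData d → SiteData d → SiteData d := fun s s' => (s'.1, Function.update s'.2 b.2
    (latticePoint a.1 - latticePoint b.1 + (s.1 + s.2 a.2.rev) - s'.1)) with hK
  have hKm : Measurable fun l : (Fin d → ℤ) → SiteData d =>
      Function.update l b.1 (K (l a.1) (l b.1)) := by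
    refine (measurable_update_pair (X := fun _ : Fin d → ℤ => SiteData d) b.1).comp
      (g := fun p : ((Fin d → ℤ) → SiteData d) × SiteData d => Function.update p.1 b.1 p.2)
      (f := fun l => (l, K (l a.1) (l b.1))) ?_
    refine measurable_id.prodMk (Measurable.prodMk (by fun_prop) ?_)
    exact (measurable_update_pair (X := fun _ : Fin 2 => EuclideanSpace ℝ (Fin d)) b.2).comp
      (g := fun p : (Fin 2 → EuclideanSpace ℝ (Fin d)) × EuclideanSpace ℝ (Fin d) =>
        Function.update p.1 b.2 p.2)
      (f := fun l : (Fin d → ℤ) → SiteData d => ((l b.1).2, latticePoint a.1 - latticePoint b.1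
        + ((l a.1).1 + (l a.1).2 a.2.rev) - (l b.1).1)) (by fun_prop)
  suffices h : ∀ᵐ l ∂fieldLaw d t δ,
      asConfig (pointsOff a.1 (Function.update l b.1 (K (l a.1) (l b.1)))) ∉ N by
    filter_upwards [h, ae_fieldPoint_injective hd hδ] with l h1 h2
    rwa [range_fieldPoint_diff_pair h2 (Ne.symm hs)]
  have hNm : MeasurableSet {l : (Fin d → ℤ) → SiteData d | asConfig (pointsOff a.1 l) ∉ N} :=
    (measurable_pointsOff a.1 hN).compl
  have hm := hKm hNm
  -- All sites but those of `a` and `b` are frozen. Since `pointsOff a.1` ignores the site of `a`,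
  -- the data `s` of that site enter only through the displacement placed at `b`, the situation of
  -- `ae_siteLaw_replace`.
  refine ae_of_ae_update _ b.1 hm (ae_of_ae_update _ a.1 ?_ ?_)
  · exact measurable_measure_prodMk_left (ν := siteLaw d t δ)
      (measurable_update_pair (X := fun _ : Fin d → ℤ => SiteData d) b.1 hm).compl
      (measurableSet_singleton 0)
  filter_upwards [ae_update_of_ae _ b.1 hoff] with l hl
  filter_upwards [ae_siteLaw_replace hδ (measurable_update l hNm) hl a.2.rev b.2
    (latticePoint a.1 - latticePoint b.1)] with s hs1
  filter_upwards [hs1] with s' hs2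
  convert hs2 using 2
  refine congrArg asConfig (pointsOff_congr fun w hw => ?_)
  by_cases hwb : w = b.1
  · subst hwb
    simp [hK, Ne.symm hs]
  · simp [hwb, hw]

end FieldProperties

-- Transfer to the paired lattice and conclusion

section PairedLattice

open Measure
open scoped ENNReal NNReal

variable {d : ℕ} {t δ : ℝ} {Ω : Type*} [MeasurableSpace Ω] {μ : Measure Ω}

/-- The field of the displacements, indexed by the sites. -/
def displacementField (Y : (Fin d → ℤ) → Ω → EuclideanSpace ℝ (Fin d))
    (Y' : (Fin d → ℤ) × Fin 2 → Ω → EuclideanSpace ℝ (Fin d)) (ω : Ω) (x : Fin d → ℤ) :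
    SiteData d :=
  (Y x ω, fun i => Y' (x, i) ω)

omit [MeasurableSpace Ω] in
lemma pairedLattice_eq (Y : (Fin d → ℤ) → Ω → EuclideanSpace ℝ (Fin d))
    (Y' : (Fin d → ℤ) × Fin 2 → Ω → EuclideanSpace ℝ (Fin d)) :
    pairedLattice Y Y' = fun ω => Set.range (fieldPoint (displacementField Y Y' ω)) := rfl

/-- The displacements of the paired lattice form a field of independent sites. -/
lemma IsGaussianPerturbationPair.measurePreserving [IsProbabilityMeasure μ] {σ : ℝ}
    (hσ : σ ^ 2 - δ ^ 2 = t ^ 2)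
    {Y : (Fin d → ℤ) → Ω → EuclideanSpace ℝ (Fin d)}
    {Y' : (Fin d → ℤ) × Fin 2 → Ω → EuclideanSpace ℝ (Fin d)}
    (h : IsGaussianPerturbationPair μ σ δ Y Y') :
    MeasurePreserving (displacementField Y Y') μ (fieldLaw d t δ) := by
  -- The three displacements of a site are gathered under indices in `Fin 3`, with 0 for the common
  -- one, so that the product measure can be curried over sites and then split at index 0.
  let g : (Fin d → ℤ) × Fin 3 → (Fin d → ℤ) ⊕ ((Fin d → ℤ) × Fin 2) := fun p =>
    Fin.cases (.inl p.1) (fun i => .inr (p.1, i)) p.2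
  have hg : Function.Injective g := by
    rintro ⟨x, i⟩ ⟨y, j⟩ hxy
    induction i using Fin.cases <;> induction j using Fin.cases <;> simp_all [g]
  have hYm : ∀ s, Measurable (Sum.elim Y Y' s) :=
    Sum.rec h.measurable_site h.measurable_point
  let ν : Fin 3 → Measure (EuclideanSpace ℝ (Fin d)) :=
    Fin.cons (isoGaussian d t) fun _ => isoGaussian d δ
  have hν : ∀ i, IsProbabilityMeasure (ν i) := by
    intro i
    induction i using Fin.cases <;> simp only [ν, Fin.cons_zero, Fin.cons_succ] <;> infer_instance
  have hlaw : ∀ p, μ.map (Sum.elim Y Y' (g p)) = ν p.2 := by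
    rintro ⟨x, i⟩
    induction i using Fin.cases with
    | zero => simpa [g, ν, isoGaussian, ← hσ] using (h.law_site x).map_eq
    | succ i => simpa [g, ν, isoGaussian] using (h.law_point (x, i)).map_eq
  have h1 : μ.map (fun ω p => Sum.elim Y Y' (g p) ω)
      = infinitePi fun p : (Fin d → ℤ) × Fin 3 => ν p.2 := by
    rw [(h.indep.precomp hg).map_fun_eq_infinitePi_map fun p => hYm (g p)]
    simp_rw [hlaw]
  have h2 := infinitePi_map_curry fun (_ : Fin d → ℤ) (i : Fin 3) => ν i
  rw [← h1, map_map (by fun_prop) (measurable_pi_lambda _ fun p => hYm (g p))] at h2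
  have hsite : MeasurePreserving (MeasurableEquiv.piFinSuccAbove
      (fun _ : Fin 3 => EuclideanSpace ℝ (Fin d)) 0) (infinitePi ν) (siteLaw d t δ) := by
    have := measurePreserving_piFinSuccAbove ν 0
    rwa [← infinitePi_eq_pi, ← infinitePi_eq_pi] at this
  have h3 := infinitePi_map_pi (fun _ : Fin d → ℤ => infinitePi ν)
    fun _ => (MeasurableEquiv.piFinSuccAbove
      (fun _ : Fin 3 => EuclideanSpace ℝ (Fin d)) 0).measurable
  have hsites : Measurable fun (l : (Fin d → ℤ) → Fin 3 → EuclideanSpace ℝ (Fin d)) x =>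
      MeasurableEquiv.piFinSuccAbove (fun _ : Fin 3 => EuclideanSpace ℝ (Fin d)) 0 (l x) :=
    measurable_pi_lambda _ fun x => hsite.measurable.comp (measurable_pi_apply x)
  rw [hsite.map_eq, ← h2, map_map hsites ((MeasurableEquiv.measurable _).comp
    (measurable_pi_lambda _ fun p => hYm (g p)))] at h3
  exact ⟨measurable_pi_lambda _ fun x => (h.measurable_site x).prodMk
    (measurable_pi_lambda _ fun i => h.measurable_point (x, i)), h3⟩

lemma measurable_range_fieldPoint_diff {ι : Type*} [Countable ι]
    {f : Ω → (Fin d → ℤ) → SiteData d} (hf : Measurable f)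
    {Z : ι → Ω → EuclideanSpace ℝ (Fin d)} (hZ : ∀ i, Measurable (Z i)) :
    Measurable (β := PointConfig (EuclideanSpace ℝ (Fin d)))
      fun ω => (Set.range (fieldPoint (f ω)) \ Set.range fun i => Z i ω : Set _) := by
  have := measurable_config_of_countable (f := fun q ω => fieldPoint (f ω) q)
    (C := fun q => ⋂ i, {ω | fieldPoint (f ω) q = Z i ω}ᶜ)
    (fun q => (measurable_fieldPoint q).comp hf)
    fun q => .iInter fun i =>
      (measurableSet_eq_fun ((measurable_fieldPoint q).comp hf) (hZ i)).compl
  refine (congrArg (Measurable (β := PointConfig (EuclideanSpace ℝ (Fin d))))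
    (funext fun ω => Set.ext fun z => ?_)).mpr this
  simp only [Set.mem_sdiff, Set.mem_range, not_exists, Set.mem_iInter, Set.mem_compl_iff,
    Set.mem_ofPred_eq]
  constructor
  · rintro ⟨⟨q, rfl⟩, h⟩
    exact ⟨q, fun i hi => h i hi.symm, rfl⟩
  · rintro ⟨q, h, rfl⟩
    exact ⟨⟨q, rfl⟩, fun i hi => h i hi.symm⟩

lemma processLaw_range_fieldPoint {f : Ω → (Fin d → ℤ) → SiteData d}
    (hf : MeasurePreserving f μ (fieldLaw d t δ)) :
    processLaw μ (fun ω => Set.range (fieldPoint (f ω)))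
      = (fieldLaw d t δ).map (β := PointConfig (EuclideanSpace ℝ (Fin d)))
        fun l => Set.range (fieldPoint l) := by
  rw [← hf.map_eq, map_map measurable_range_fieldPoint hf.measurable]
  rfl

lemma finite_range_inter_ball {l : (Fin d → ℤ) → SiteData d}
    (hl : ∀ (c : EuclideanSpace ℝ (Fin d)) (r : ℝ), {q | fieldPoint l q ∈ Metric.ball c r}.Finite)
    (c : EuclideanSpace ℝ (Fin d)) (r : ℝ) :
    (Set.range (fieldPoint l) ∩ Metric.ball c r).Finite := by
  refine ((hl c r).image (fieldPoint l)).subset ?_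
  rintro _ ⟨⟨q, rfl⟩, hq⟩
  exact ⟨q, hq, rfl⟩

lemma isPointProcess_range_fieldPoint (ht : 0 < t) (hδ : 0 < δ)
    {f : Ω → (Fin d → ℤ) → SiteData d} (hf : MeasurePreserving f μ (fieldLaw d t δ)) :
    IsPointProcess μ fun ω => Set.range (fieldPoint (f ω)) := by
  refine ⟨measurable_range_fieldPoint.comp hf.measurable, ?_⟩
  filter_upwards [hf.quasiMeasurePreserving.ae (ae_finite_fieldPoint_mem_ball ht hδ)] with ω hω
  exact finite_range_inter_ball hω

/-- `Z` may use randomness beyond the field, so the second law is treated as an image of the joint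
law of field and deleted point. `IsShortPairing.range_ne` then keeps the two configurations from
ever agreeing. -/
lemma isDeletionSingular_range_fieldPoint (hd : 0 < d) (ht : 0 < t) (hδ : 0 < δ)
    (hshort : ∀ᵐ l ∂fieldLaw d t δ, IsShortPairing l1dist (fieldPoint l))
    {f : Ω → (Fin d → ℤ) → SiteData d} (hf : MeasurePreserving f μ (fieldLaw d t δ)) :
    IsDeletionSingular μ fun ω => Set.range (fieldPoint (f ω)) := by
  intro Z hZ
  have hfZ : Measurable fun ω => (f ω, Z ω) := hf.measurable.prodMk hZ.1
  have hF₂ : Measurable (β := PointConfig (EuclideanSpace ℝ (Fin d)))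
      fun p : ((Fin d → ℤ) → SiteData d) × EuclideanSpace ℝ (Fin d) =>
        (Set.range (fieldPoint p.1) \ {p.2} : Set (EuclideanSpace ℝ (Fin d))) := by
    simpa using measurable_range_fieldPoint_diff measurable_fst
      (Z := fun (_ : Unit) (p : ((Fin d → ℤ) → SiteData d) × EuclideanSpace ℝ (Fin d)) => p.2)
      fun _ => measurable_snd
  have hlaw₂ : processLaw μ (fun ω => Set.range (fieldPoint (f ω)) \ {Z ω})
      = (μ.map fun ω => (f ω, Z ω)).map (β := PointConfig (EuclideanSpace ℝ (Fin d)))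
        fun p => (Set.range (fieldPoint p.1) \ {p.2} : Set (EuclideanSpace ℝ (Fin d))) := by
    rw [map_map hF₂ hfZ]
    rfl
  rw [processLaw_range_fieldPoint hf, hlaw₂]
  have hgood : ∀ᵐ l ∂fieldLaw d t δ, IsShortPairing l1dist (fieldPoint l) ∧
      Function.Injective (fieldPoint l) ∧ ∀ (c : EuclideanSpace ℝ (Fin d)) (r : ℝ),
        {q | fieldPoint l q ∈ Metric.ball c r}.Finite := by
    filter_upwards [hshort, ae_fieldPoint_injective hd hδ, ae_finite_fieldPoint_mem_ball ht hδ]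
      with l h1 h2 h3
    exact ⟨h1, h2, h3⟩
  have hfst : MeasurePreserving Prod.fst (μ.map fun ω => (f ω, Z ω)) (fieldLaw d t δ) :=
    ⟨measurable_fst, by rw [map_map measurable_fst hfZ]; exact hf.map_eq⟩
  have hmem : ∀ᵐ p ∂μ.map fun ω => (f ω, Z ω), p.2 ∈ Set.range (fieldPoint p.1) := by
    refine (ae_map_iff hfZ.aemeasurable ?_).2 hZ.2
    have : {p : ((Fin d → ℤ) → SiteData d) × EuclideanSpace ℝ (Fin d) |
        p.2 ∈ Set.range (fieldPoint p.1)} = ⋃ q, {p | fieldPoint p.1 q = p.2} := by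
      ext; simp
    rw [this]
    exact .iUnion fun q => measurableSet_eq_fun ((measurable_fieldPoint q).comp measurable_fst)
      measurable_snd
  have : StandardBorelSpace (SiteData d) := inferInstance
  have : StandardBorelSpace ((Fin d → ℤ) → SiteData d) := .pi_countable
  refine mutuallySingular_map_of_ne measurable_range_fieldPoint hF₂ hgood
    ((hfst.quasiMeasurePreserving.ae hgood).and hmem) ?_ ?_ ?_
  · exact fun l hl => isClosed_of_finite_inter_ball (finite_range_inter_ball hl.2.2)
  · exact fun p hp => isClosed_of_finite_inter_ball fun c r =>
      (finite_range_inter_ball hp.1.2.2 c r).subset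
        (Set.inter_subset_inter_left _ Set.sdiff_subset)
  · exact fun l p hl hp => hl.1.range_ne l1dist_nonneg hl.2.1 hp.1.2.1 hp.1.1 hp.2

/-- There are countably many pairs of labels, so almost surely the exceptional set is avoided for
all of them at once, in particular for the random pair of labels of the two deleted points. -/
lemma isDeletionTolerant_range_fieldPoint (hd : 0 < d) (hδ : 0 < δ)
    (hoff : ∀ x, ∀ N : Set (PointConfig (EuclideanSpace ℝ (Fin d))), MeasurableSet N →
      fieldLaw d t δ {l | asConfig (Set.range (fieldPoint l)) ∈ N} = 0 →
      fieldLaw d t δ {l | asConfig (pointsOff x l) ∈ N} = 0)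
    {f : Ω → (Fin d → ℤ) → SiteData d} (hf : MeasurePreserving f μ (fieldLaw d t δ)) :
    IsDeletionTolerant 2 μ fun ω => Set.range (fieldPoint (f ω)) := by
  intro Z hZ hinj
  refine AbsolutelyContinuous.mk fun N hN h0 => ?_
  rw [processLaw_range_fieldPoint hf, map_apply measurable_range_fieldPoint hN] at h0
  rw [processLaw, map_apply (measurable_range_fieldPoint_diff hf.measurable fun i => (hZ i).1) hN,
    measure_eq_zero_iff_ae_notMem]
  have hpair : ∀ᵐ l ∂fieldLaw d t δ, ∀ a b, a ≠ b →
      asConfig (Set.range (fieldPoint l) \ {fieldPoint l a, fieldPoint l b}) ∉ N :=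
    ae_all_iff.2 fun a => ae_all_iff.2 fun b => ae_all_iff.2 fun hab =>
      ae_range_fieldPoint_diff_notMem hd hδ hN (fun x => hoff x N hN h0) hab
  filter_upwards [hf.quasiMeasurePreserving.ae hpair, hinj, (hZ 0).2, (hZ 1).2]
    with ω h1 h2 h3 h4
  obtain ⟨a, ha⟩ := h3
  obtain ⟨b, hb⟩ := h4
  have hrange : (Set.range fun i => Z i ω) = {fieldPoint (f ω) a, fieldPoint (f ω) b} := by
    ext z
    simp [Fin.exists_fin_two, ha, hb, eq_comm]
  change asConfig (Set.range (fieldPoint (f ω)) \ Set.range fun i => Z i ω) ∉ N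
  rw [hrange]
  refine h1 a b fun hab => ?_
  have := h2 (ha.symm.trans (hab ▸ hb))
  simp at this

/-- Rigidity is a property of the law, so by tolerance it passes to the configuration without the
two points of site 0. If both lie in the ball, the outside is unchanged while the finite count
drops. Hence almost surely no ball about 0 of radius n + 1 contains both, which is absurd. -/
lemma not_isRigid_range_fieldPoint [IsProbabilityMeasure μ] (hd : 0 < d) (ht : 0 < t) (hδ : 0 < δ)
    {f : Ω → (Fin d → ℤ) → SiteData d} (hf : MeasurePreserving f μ (fieldLaw d t δ))
    (htol : IsDeletionTolerant 2 μ fun ω => Set.range (fieldPoint (f ω))) :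
    ¬ IsRigid μ fun ω => Set.range (fieldPoint (f ω)) := by
  intro hrig
  set Z : Fin 2 → Ω → EuclideanSpace ℝ (Fin d) := fun i ω => fieldPoint (f ω) (0, i) with hZ
  have hZm : ∀ i, Measurable (Z i) := fun i => (measurable_fieldPoint (0, i)).comp hf.measurable
  have hinj := hf.quasiMeasurePreserving.ae (ae_fieldPoint_injective (t := t) hd hδ)
  have hac := htol Z (fun i => ⟨hZm i, .of_forall fun ω => ⟨(0, i), rfl⟩⟩) <| by
    filter_upwards [hinj] with ω hω i j hij
    exact congrArg Prod.snd (hω hij)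
  have hnot : ∀ n : ℕ, ∀ᵐ ω ∂μ, ¬ ∀ i, Z i ω ∈ Metric.ball 0 ((n : ℝ) + 1) := by
    intro n
    set B : Set (EuclideanSpace ℝ (Fin d)) := Metric.ball 0 ((n : ℝ) + 1) with hB
    obtain ⟨N, hNm, hN⟩ := hrig 0 ((n : ℝ) + 1) (by positivity)
    set M : Set (PointConfig (EuclideanSpace ℝ (Fin d))) :=
      {s | N ((show Set (EuclideanSpace ℝ (Fin d)) from s) ∩ Bᶜ : Set _)
        = ((show Set (EuclideanSpace ℝ (Fin d)) from s) ∩ B).encard} with hM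
    have hBm : MeasurableSet B := measurableSet_ball
    have hMm : MeasurableSet M := measurableSet_eq_fun
      (hNm.comp (measurable_config_inter hBm.compl)) (measurable_encard_inter hBm)
    have hPm : Measurable (β := PointConfig (EuclideanSpace ℝ (Fin d)))
      fun ω => Set.range (fieldPoint (f ω)) := measurable_range_fieldPoint.comp hf.measurable
    have hDm : Measurable (β := PointConfig (EuclideanSpace ℝ (Fin d)))
        fun ω => (Set.range (fieldPoint (f ω)) \ Set.range fun i => Z i ω : Set _) :=
      measurable_range_fieldPoint_diff hf.measurable hZm
    have h1 : ∀ᵐ s ∂processLaw μ fun ω => Set.range (fieldPoint (f ω)), s ∈ M :=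
      (ae_map_iff hPm.aemeasurable hMm).2 hN
    have h2 := (ae_map_iff hDm.aemeasurable hMm).1 (hac.ae_le h1)
    filter_upwards [hN, h2,
      hf.quasiMeasurePreserving.ae (ae_finite_fieldPoint_mem_ball ht hδ)] with ω h3 h4 h5 h6
    have h4 : N (((Set.range (fieldPoint (f ω)) \ Set.range fun i => Z i ω) ∩ Bᶜ : Set _))
      = ((Set.range (fieldPoint (f ω)) \ Set.range fun i => Z i ω) ∩ B).encard := h4
    have h7 : (Set.range (fieldPoint (f ω)) \ Set.range fun i => Z i ω) ∩ Bᶜ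
        = Set.range (fieldPoint (f ω)) ∩ Bᶜ := by
      ext z
      simp only [Set.mem_inter_iff, Set.mem_sdiff, Set.mem_compl_iff]
      refine ⟨fun h => ⟨h.1.1, h.2⟩, fun h => ⟨⟨h.1, ?_⟩, h.2⟩⟩
      rintro ⟨i, rfl⟩
      exact h.2 (h6 i)
    rw [h7] at h4
    rw [h3] at h4
    refine (Set.Finite.encard_lt_encard ((finite_range_inter_ball h5 0 ((n : ℝ) + 1)).subset
      (Set.inter_subset_inter_left B Set.sdiff_subset)) ?_).ne h4.symm
    refine (Set.ssubset_iff_of_subset (Set.inter_subset_inter_left B Set.sdiff_subset)).2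
      ⟨Z 0 ω, ⟨⟨(0, 0), rfl⟩, h6 0⟩, fun h => h.1.2 ⟨0, rfl⟩⟩
  obtain ⟨ω, hω⟩ := (ae_all_iff.2 hnot).exists
  obtain ⟨n, hn⟩ := exists_nat_ge (∑ i, ‖Z i ω‖)
  refine hω n fun i => ?_
  rw [mem_ball_zero_iff]
  have := Finset.single_le_sum (f := fun i => ‖Z i ω‖) (fun j _ => norm_nonneg (Z j ω))
    (Finset.mem_univ i)
  linarith

end PairedLattice

theorem theorem1p5 (d : ℕ) (hd : 3 ≤ d) :
    ∃ δ σ : ℝ, 0 < δ ∧ δ < σ ∧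
      ∀ (Ω : Type*) [MeasurableSpace Ω] (μ : Measure Ω) [IsProbabilityMeasure μ]
        (Y : (Fin d → ℤ) → Ω → EuclideanSpace ℝ (Fin d))
        (Y' : (Fin d → ℤ) × Fin 2 → Ω → EuclideanSpace ℝ (Fin d)),
        IsGaussianPerturbationPair μ σ δ Y Y' →
          IsPointProcess μ (pairedLattice Y Y') ∧
          IsDeletionSingular μ (pairedLattice Y Y') ∧
          IsDeletionTolerant 2 μ (pairedLattice Y Y') ∧
          ¬ IsRigid μ (pairedLattice Y Y') := by
  have hd0 : 0 < d := by omega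
  have : NeZero d := ⟨hd0.ne'⟩
  -- The order matters: `t` depends on `d` alone and serves every δ in the tolerance argument, while
  -- the δ of the short pairing depends on `t`.
  obtain ⟨t, ht, ε, hε, hε1, hεt⟩ := exists_variance_bound d
  obtain ⟨δ, hδ, hshort⟩ := exists_ae_isShortPairing hd0 ht
  refine ⟨δ, √(t ^ 2 + δ ^ 2), hδ, Real.lt_sqrt_of_sq_lt (by nlinarith), ?_⟩
  intro Ω _ μ _ Y Y' h
  have hf := h.measurePreserving (t := t) (by rw [Real.sq_sqrt (by positivity)]; ring)
  have htol := isDeletionTolerant_range_fieldPoint hd0 hδ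
    (fun x N hN h0 => pointsOff_null hd ht hε hε1 hεt x hN h0) hf
  rw [pairedLattice_eq]
  exact ⟨isPointProcess_range_fieldPoint ht hδ hf,
    isDeletionSingular_range_fieldPoint hd0 ht hδ hshort hf, htol,
    not_isRigid_range_fieldPoint hd0 ht hδ hf htol⟩
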